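/- **Model.** There are $n$ validators. Time is divided into rounds $0,1,2,\dots$; with $\Delta\ge 1$, slot $t$ consists of the rounds $4\Delta t,\dots,4\Delta t+4\Delta-1$; its propose, voting, fast-confirmation and merge rounds are $4\Delta t$, $v(t):=4\Delta t+\Delta$, $4\Delta t+2\Delta$ and $4\Delta t+3\Delta$. A block is a batch of transactions with a slot $p\ge 0$, larger than the slot of its parent; genesis has slot $-1$. A chain is the path from genesis to a block, identified with its tip; $\mathsf{ch}.p$ (its length) is the slot of the tip; $\preceq$ is the prefix relation; two chains conflict if neither is a prefix of the other. $\max$ of a set of chains is one with the largest $p$. $\mathsf{ch}^{\lceil\kappa}$ at slot $t$ is the longest prefix of $\mathsf{ch}$ with $p\le t-\kappa$ (genesis if there is none). Let $A_r$ be the (increasing) set of validators corrupted by round $r$; the others are honest. An adversary chooses corruptions and which honest validators are awake. Sleeping validators pause and their incoming messages are queued. An awake honest validator is *active* in round $r$ if it has been awake since round $0$, or if for some slot $t\ge1$ with $v(t)\le r$ it has been awake in all rounds from $v(t-1)+\Delta$ to $r$; $H_r$ is the set of active validators. Awake honest validators that are not active receive and relay messages and maintain their frozen state, but send no proposals or votes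 and do not update their outputs. Assume: (i) $|\bigcup_r A_r|<n/3$; (ii) $|H_{v(t-1)}\setminus A_{v(t)}|>|A_{v(t)}|$ for every slot $t\ge 1$; (iii) a proposer active in round $4\Delta t$ of its slot is not corrupted by round $v(t)$. Network ($\mathrm{GST}=0$): views are finite, grow, and are empty in round $0$; a message sent by an honest validator in round $r$, and every vote in the view of an awake honest validator in round $r$, is in the view of each honest validator awake in a round $r'\ge r+\Delta$; a proposal for slot $t$ held by an awake honest validator in a round of $[4\Delta t,4\Delta t+\Delta)$ is relayed likewise; votes contained in a received proposal are received; a message in an honest view in round $r$ whose sender is honest in round $r$ was sent by it in an earlier round. Proposer election: let $\mathcal F_t$ be a filtration. The proposer $v_p^t$ of slot $t$ is uniform on the $n$ validators, independent of $\mathcal F_t$ and $\mathcal F_{t+1}$-measurable, and $H_{4\Delta t}$ is $\mathcal F_t$-measurable. Executions are otherwise an arbitrary function of the random outcome. **Functions.** Votes are $[\textsc{vote},\mathsf{ch},\cdot,t,v]$. For a set $V$ of votes, $V^{\mathsf{ch},t}$ is obtained by discarding all votes of validators that have in $V$ two votes of the same slot for different chains, then the votes of slots $<t-1$, then all but the latest-slot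 votes of each validator, and keeping the votes for chains $\succeq\mathsf{ch}$. $\mathrm{MFC}(V,V',\mathsf{ch}^C,t)$ is the longest $\mathsf{ch}\succeq \mathsf{ch}^C$ such that $\mathsf{ch}=\mathsf{ch}^C$ or the number of validators with a vote in $V^{\mathsf{ch},t}\cap V'^{\mathsf{ch},t}$ exceeds half the number of validators with a vote of slot $\ge t-1$ in $V'$. $\mathrm{fcs}(V,s)$: let $K$ be the set of chains $\mathsf{ch}$ such that at least $\frac23n$ validators have a slot-$s$ vote in $V$ for a chain $\succeq\mathsf{ch}$ (a *quorum* for $\mathsf{ch}$); if $K\ne\emptyset$ return $(\mathsf c,Q)$ with $\mathsf c=\max K$ and $Q$ the slot-$s$ votes in $V$ for chains $\succeq \mathsf c$; otherwise return $(\text{genesis},\emptyset)$. $\mathrm{Extend}(\mathsf{ch},t)$, for $\mathsf{ch}.p<t$, is a chain $\succeq \mathsf{ch}$ with $p=t$ containing all transactions in the pool at round $4\Delta t$; it is unspecified if $\mathsf{ch}.p\ge t$. **Protocol 1** (validator $v_i$ with view $V_i$; outputs $\mathsf{Ch}_i$; initially $\mathsf{Ch}_i=\mathsf{ch}^{fr}_i=$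 genesis, $V^{fr}_i=\emptyset$). *Propose:* an active $v_i=v_p^t$ computes $(\mathsf{ch}^C,Q^C)=\mathrm{fcs}(V_i,t-1)$ and $\mathsf m=\mathrm{MFC}(V_i,V_i,\mathsf{ch}^C,t)$, and sends $[\textsc{propose},\mathrm{Extend}(\mathsf m,t),\mathsf{ch}^C,Q^C,\cdot,t,v_i]$. *On receiving, in a round of* $[4\Delta t,v(t)]$, a proposal $[\textsc{propose},\mathsf{ch}_p,\mathsf{ch}^C_p,Q_p,\cdot,t,v_p^t]$ that is valid ($\mathsf{ch}_p.p=t$, and $\mathsf{ch}^C_p$ is genesis or $Q_p$ contains a slot-$(t-1)$ quorum for it) with $\mathsf{ch}^{fr}_i\preceq\mathsf{ch}^C_p$: $\mathsf{ch}^{fr}_i\gets \mathsf{ch}^C_p$. *Vote:* $\mathsf m:=\mathrm{MFC}(V^{fr}_i,V_i,\mathsf{ch}^{fr}_i,t)$; $\mathsf{Ch}_i\gets\max\{\mathsf{ch}\in\{\mathsf{Ch}_i,\mathsf m^{\lceil\kappa}\}:\mathsf{ch}\preceq\mathsf m\}$; send a slot-$t$ vote for a received chain that was proposed by $v_p^t$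 for slot $t$, extends $\mathsf m$ and has $p=t$, if there is one, and for $\mathsf m$ otherwise. *Fast confirm:* $(\mathsf c,Q)=\mathrm{fcs}(V_i,t)$; if $Q\neq\emptyset$ then $\mathsf{Ch}_i\gets \mathsf c$. *Merge:* $V^{fr}_i\gets V_i$; $\mathsf{ch}^{fr}_i\gets$ first component of $\mathrm{fcs}(V_i,t)$. **Protocol 2.** A checkpoint is a pair $(\mathsf{ch},c)$ of a chain and a slot. Votes carry in addition a pair of checkpoints $S\to T$. $(\text{genesis},0)$ is justified in $V$, and so is $T$ whenever $S$ is justified in $V$, $S.\mathsf{ch}\preceq T.\mathsf{ch}$, $S.c<T.c$ and at least $\frac23n$ validators have a vote carrying $S\to T$ in $V$ (a link $S\to T$). $\mathrm{GJ}(V)$ is the justified checkpoint with the largest $c$. A checkpoint $C$ is finalized if it is $(\text{genesis},0)$ or if it is justified and has a link to some $T$ with $T.c=C.c+1$; $\mathrm{GF}(V)$ is the finalized checkpoint with the largest $c$. $\mathrm{fc}(V,s)=\mathrm{fcs}(V,s)$ if its chain extends $\mathrm{GJ}(V).\mathsf{ch}$, and $(\mathrm{GJ}(V).\mathsf{ch},\emptyset)$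 otherwise. The outputs are $\mathsf{chAva}_i$ and $\mathsf{chFin}_i$ (initially genesis), and there is an additional state variable $\mathrm{GJ}^{fr}_i$ (initially $(\text{genesis},0)$). The protocol is Protocol 1 with the following changes. *Propose* uses $\mathrm{fc}$ for $\mathrm{fcs}$ and includes $\mathrm{GJ}(V_i)$ in the proposal. Proposals received in $[4\Delta t,v(t)]$ are handled at round $v(t)$, before voting: a proposal with checkpoint $G$ is valid if $\mathsf{ch}_p.p=t$ and $\mathsf{ch}^C_p=G.\mathsf{ch}$ or $Q_p$ contains a slot-$(t-1)$ quorum for $\mathsf{ch}^C_p$; if it is valid, $G$ is justified in $V_i$, and $G=\mathrm{GJ}^{fr}_i$ or $G.c>\mathrm{GJ}^{fr}_i.c$, then $\mathrm{GJ}^{fr}_i\gets G$; $\mathsf{ch}^{fr}_i\gets G.\mathsf{ch}$ if $\mathsf{ch}^{fr}_i\not\succeq G.\mathsf{ch}$; and then $\mathsf{ch}^{fr}_i\gets\mathsf{ch}^C_p$ if $\mathsf{ch}^{fr}_i\preceq\mathsf{ch}^C_p$. *Vote:* $\mathsf{chAva}_i\gets\max\{\mathsf{ch}\in\{\mathsf{chAva}_i,\mathsf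 m^{\lceil\kappa},\mathrm{GJ}^{fr}_i.\mathsf{ch}\}:\mathsf{ch}\preceq\mathsf m\}$; $\mathsf{chFin}_i\gets\max\{\mathsf{ch}:\mathsf{ch}\preceq\mathsf{chAva}_i,\ \mathsf{ch}\preceq\mathrm{GF}(V_i).\mathsf{ch}\}$; the vote carries $\mathrm{GJ}^{fr}_i\to T$ with $T=(\mathsf{chAva}_i,t)$ if $\mathrm{GJ}^{fr}_i.c=t-1$ and $T=(\mathrm{GJ}^{fr}_i.\mathsf{ch},t)$ otherwise. *Fast confirm:* $\mathsf{chAva}_i\gets\mathsf c$ if $\mathsf{chAva}_i\not\succeq \mathsf c$, where $\mathsf c$ is the chain of $\mathrm{fc}(V_i,t)$; $\mathsf{chFin}_i\gets\mathrm{GF}(V_i).\mathsf{ch}$. *Merge* uses $\mathrm{fc}$ and sets $\mathrm{GJ}^{fr}_i\gets\mathrm{GJ}(V_i)$. **Theorem (Reorg resilience).** Let $T$ be a number of slots and let $h$ be such that $|H_{4\Delta t}|\ge h$ for all slots $t<T$. For Protocol 1 with output $\mathsf{Ch}$, and likewise for Protocol 2 with output $\mathsf{chAva}$, the following two properties hold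 together except on an event of probability at most $T\,(1-h/n)^{\kappa}$: 1. any chain proposed in a slot $t<T$ by a validator honest in round $4\Delta t$ does not conflict with the output, after any round $r<4\Delta T$, of any validator honest in round $r$; 2. for every validator $v_i$ honest in a round $r$, its output after round $r$ is a prefix of the fork choice of every validator $v_j\in H_{r'}$ at every propose or voting round $r'\ge r$ of a slot $t<T$. Here the fork choice is $\mathsf m$ as computed in the Vote step if $r'=v(t)$; if $r'=4\Delta t$ it is $\mathsf m$ as the Propose step defines it, for $v_j$ in place of the proposer. -/

import Mathlib

open MeasureTheory ProbabilityTheory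
open scoped ENNReal

noncomputable section

namespace Sleepy

/-! ### Blocks and chains -/

/-- A non-genesis block: a batch of transactions and the slot in which it is proposed. -/
structure Block (Tx : Type) where
  body : Finset Tx
  slot : ℕ

/-- A chain, given by its non-genesis blocks listed from genesis to the tip.
A child has a larger slot than its parent. The empty list is the genesis chain. -/
@[ext] structure Chain (Tx : Type) where
  blocks : List (Block Tx)
  increasing : blocks.Pairwise (fun a b => a.slot < b.slot)

namespace Chain

variable {Tx : Type}

def genesis : Chain Tx := ⟨[], List.Pairwise.nil⟩

/-- The slot of the tip of a chain; genesis has slot `-1`. -/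
def p (C : Chain Tx) : ℤ :=
  match C.blocks.getLast? with
  | none => -1
  | some b => (b.slot : ℤ)

/-- `C.Pre D`: the chain `C` is a (not necessarily strict) prefix of `D`; `D` extends `C`. -/
def Pre (C D : Chain Tx) : Prop := C.blocks <+: D.blocks

def Conflict (C D : Chain Tx) : Prop := ¬ C.Pre D ∧ ¬ D.Pre C

def HasTx (C : Chain Tx) (x : Tx) : Prop := ∃ b ∈ C.blocks, x ∈ b.body

open Classical in
/-- A chain of maximal height in `X` (ties are broken arbitrarily);
genesis if there is none. -/
def longest (X : Set (Chain Tx)) : Chain Tx :=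
  if h : ∃ C ∈ X, ∀ D ∈ X, D.p ≤ C.p then h.choose else genesis

/-- The `κ`-deep prefix at slot `t`: the longest prefix with height at most `t - κ`
(genesis if `t - κ < -1`). -/
def deepPrefix (C : Chain Tx) (κ t : ℕ) : Chain Tx :=
  longest {D | D.Pre C ∧ D.p ≤ (t : ℤ) - κ}

end Chain

/-! ### Messages. `Φ` is the type of the finality component of a vote and `Γ` the type of
the checkpoint component of a proposal; both are `Unit` for the protocol without finality. -/

/-- The message `[vote, chain, fin, slot, sender]`. -/
structure Vote (Tx : Type) (n : ℕ) (Φ : Type) where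
  chain : Chain Tx
  fin : Φ
  slot : ℕ
  sender : Fin n

/-- The message `[propose, chain, chainC, quorum, gj, slot, sender]`. -/
structure Proposal (Tx : Type) (n : ℕ) (Φ Γ : Type) where
  chain : Chain Tx
  chainC : Chain Tx
  quorum : Set (Vote Tx n Φ)
  gj : Γ
  slot : ℕ
  sender : Fin n

/-! ### Vote filters, majority fork choice, fast confirmation -/

section ForkChoice

variable {Tx : Type} {n : ℕ} {Φ : Type}

def voters (V : Set (Vote Tx n Φ)) : Set (Fin n) := {k | ∃ m ∈ V, m.sender = k}

/-- Two votes of `k` in the same slot for different chains. -/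
def Equivocates (V : Set (Vote Tx n Φ)) (k : Fin n) : Prop :=
  ∃ m ∈ V, ∃ m' ∈ V, m.sender = k ∧ m'.sender = k ∧ m.slot = m'.slot ∧ m.chain ≠ m'.chain

/-- Discards the votes of validators that equivocate in `V`. -/
def filEq (V : Set (Vote Tx n Φ)) : Set (Vote Tx n Φ) := {m ∈ V | ¬ Equivocates V m.sender}

/-- Discards the votes that are more than one slot old at slot `t`. -/
def filExp (V : Set (Vote Tx n Φ)) (t : ℕ) : Set (Vote Tx n Φ) := {m ∈ V | t ≤ m.slot + 1}

/-- Retains the latest vote of each validator. -/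
def filLmd (V : Set (Vote Tx n Φ)) : Set (Vote Tx n Φ) :=
  {m ∈ V | ∀ m' ∈ V, m'.sender = m.sender → m'.slot ≤ m.slot}

/-- Latest, non-expired, non-equivocating votes for chains extending `C`. -/
def support (V : Set (Vote Tx n Φ)) (C : Chain Tx) (t : ℕ) : Set (Vote Tx n Φ) :=
  {m ∈ filLmd (filExp (filEq V) t) | C.Pre m.chain}

/-- The majority fork-choice function. Votes are counted by validator. -/
def mfc (V V' : Set (Vote Tx n Φ)) (C : Chain Tx) (t : ℕ) : Chain Tx :=
  Chain.longest {D | C.Pre D ∧ (D = C ∨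
    (voters (filExp V' t)).ncard < 2 * (voters (support V D t ∩ support V' D t)).ncard)}

/-- The votes of slot `s` in `V` for chains extending `C`. -/
def slotVotes (V : Set (Vote Tx n Φ)) (C : Chain Tx) (s : ℤ) : Set (Vote Tx n Φ) :=
  {m ∈ V | C.Pre m.chain ∧ (m.slot : ℤ) = s}

/-- At least two thirds of all `n` validators have a slot `s` vote in `V` for an extension
of `C`. -/
def IsQuorum (V : Set (Vote Tx n Φ)) (C : Chain Tx) (s : ℤ) : Prop :=
  2 * n ≤ 3 * (voters (slotVotes V C s)).ncard

open Classical in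
def fastConfirmSimple (V : Set (Vote Tx n Φ)) (s : ℤ) : Chain Tx × Set (Vote Tx n Φ) :=
  if {C : Chain Tx | IsQuorum V C s}.Nonempty then
    (Chain.longest {C | IsQuorum V C s}, slotVotes V (Chain.longest {C | IsQuorum V C s}) s)
  else (Chain.genesis, ∅)

end ForkChoice

/-! ### Checkpoints, justification, finalization -/

@[ext] structure Checkpoint (Tx : Type) where
  chain : Chain Tx
  c : ℕ

section Finality

variable {Tx : Type} {n : ℕ}

/-- A vote of the full protocol carries a finality vote `source → target`. -/
abbrev FinVote (Tx : Type) (n : ℕ) := Vote Tx n (Checkpoint Tx × Checkpoint Tx)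

def genesisCheckpoint : Checkpoint Tx := ⟨Chain.genesis, 0⟩

/-- `S → T` is valid and at least two thirds of all validators have cast it in `V`. -/
def SupermajorityLink (V : Set (FinVote Tx n)) (S T : Checkpoint Tx) : Prop :=
  S.chain.Pre T.chain ∧ S.c < T.c ∧ 2 * n ≤ 3 * (voters {m ∈ V | m.fin = (S, T)}).ncard

inductive Justified (V : Set (FinVote Tx n)) : Checkpoint Tx → Prop
  | base : Justified V genesisCheckpoint
  | link (S T : Checkpoint Tx) : Justified V S → SupermajorityLink V S T → Justified V T

def Finalized (V : Set (FinVote Tx n)) (C : Checkpoint Tx) : Prop :=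
  C = genesisCheckpoint ∨
    (Justified V C ∧ ∃ T : Checkpoint Tx, T.c = C.c + 1 ∧ SupermajorityLink V C T)

open Classical in
/-- A checkpoint of maximal slot in `X` (ties are broken arbitrarily). -/
def greatest (X : Set (Checkpoint Tx)) : Checkpoint Tx :=
  if h : ∃ C ∈ X, ∀ D ∈ X, D.c ≤ C.c then h.choose else genesisCheckpoint

/-- The greatest justified checkpoint. -/
def gjOf (V : Set (FinVote Tx n)) : Checkpoint Tx := greatest {C | Justified V C}

/-- The greatest finalized checkpoint. -/
def gfOf (V : Set (FinVote Tx n)) : Checkpoint Tx := greatest {C | Finalized V C}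

open Classical in
def fastConfirm (V : Set (FinVote Tx n)) (s : ℤ) : Chain Tx × Set (FinVote Tx n) :=
  if (gjOf V).chain.Pre (fastConfirmSimple V s).1 then fastConfirmSimple V s
  else ((gjOf V).chain, ∅)

end Finality

/-! ### Time, adversary, and executions -/

def proposing (Δ t : ℕ) : ℕ := 4 * Δ * t

def voting (Δ t : ℕ) : ℕ := 4 * Δ * t + Δ

def fastConfirming (Δ t : ℕ) : ℕ := 4 * Δ * t + 2 * Δ

def merging (Δ t : ℕ) : ℕ := 4 * Δ * t + 3 * Δ

/-- Corruptions (never undone), sleep schedule and elected proposers. -/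
structure Env (n : ℕ) where
  corrupted : ℕ → Set (Fin n)
  corrupted_mono : Monotone corrupted
  awake : Fin n → ℕ → Prop
  proposer : ℕ → Fin n

namespace Env

variable {n : ℕ}

def Honest (E : Env n) (i : Fin n) (r : ℕ) : Prop := i ∉ E.corrupted r

/-- Honest and awake, so executing the protocol, possibly while still joining. -/
def Running (E : Env n) (i : Fin n) (r : ℕ) : Prop := E.Honest i r ∧ E.awake i r

/-- Active validators. A validator that has not been awake since round `0` becomes active at
the voting round of slot `t + 1` if it woke up by round `voting t + Δ` and has stayed awake. -/
def Active (Δ : ℕ) (E : Env n) (i : Fin n) (r : ℕ) : Prop :=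
  E.Honest i r ∧ ((∀ s ≤ r, E.awake i s) ∨
    ∃ t, voting Δ (t + 1) ≤ r ∧ ∀ s, voting Δ t + Δ ≤ s → s ≤ r → E.awake i s)

/-- The set `H_r` of active validators. -/
def active (Δ : ℕ) (E : Env n) (r : ℕ) : Set (Fin n) := {i | E.Active Δ i r}

/-- Constraints on the adversary. -/
structure Compliant (Δ : ℕ) (E : Env n) : Prop where
  /-- Less than a third of the validators is ever corrupted. -/
  few_corrupted : 3 * (⋃ r, E.corrupted r).ncard < n
  /-- The sleepiness condition, for all slots `t + 1 ≥ 1`. -/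
  sleepiness : ∀ t, (E.corrupted (voting Δ (t + 1))).ncard <
    (E.active Δ (voting Δ t) \ E.corrupted (voting Δ (t + 1))).ncard
  /-- An active proposer is not corrupted between its proposal and the voting round. -/
  proposer_protected : ∀ t, E.Active Δ (E.proposer t) (proposing Δ t) →
    E.Honest (E.proposer t) (voting Δ t)

end Env

/-- The data of an execution: transaction pool, received votes and proposals (views),
messages sent by each validator in each round, and local states after each round. -/
structure Execution (Tx : Type) (n : ℕ) (Φ Γ σ : Type) where
  env : Env n
  pool : ℕ → Finset Tx
  pool_mono : Monotone pool
  votes : Fin n → ℕ → Set (Vote Tx n Φ)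
  props : Fin n → ℕ → Set (Proposal Tx n Φ Γ)
  sentVotes : Fin n → ℕ → Set (Vote Tx n Φ)
  sentProps : Fin n → ℕ → Set (Proposal Tx n Φ Γ)
  state : Fin n → ℕ → σ

namespace Execution

variable {Tx : Type} {n : ℕ} {Φ Γ σ : Type}

/-- The state of `i` before round `r`, where `s₀` is the starting state. -/
def before (e : Execution Tx n Φ Γ σ) (s₀ : σ) (i : Fin n) : ℕ → σ
  | 0 => s₀
  | r + 1 => e.state i r

/-- The proposals received by `i` before round `r`. -/
def propsBefore (e : Execution Tx n Φ Γ σ) (i : Fin n) : ℕ → Set (Proposal Tx n Φ Γ)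
  | 0 => ∅
  | r + 1 => e.props i r

/-- The proposals for slot `t` first received by `i` in one of the rounds `a, …, b`. -/
def received (e : Execution Tx n Φ Γ σ) (i : Fin n) (t a b : ℕ) : Set (Proposal Tx n Φ Γ) :=
  {m ∈ e.props i b | m ∉ e.propsBefore i a ∧ m.slot = t}

/-- Network model with `GST = 0`: gossip, delay bound `Δ`, unforgeability. -/
structure Synchronous (Δ : ℕ) (e : Execution Tx n Φ Γ σ) : Prop where
  votes_zero : ∀ i, e.votes i 0 = ∅
  props_zero : ∀ i, e.props i 0 = ∅
  votes_mono : ∀ i, Monotone (e.votes i)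
  props_mono : ∀ i, Monotone (e.props i)
  votes_finite : ∀ i r, (e.votes i r).Finite
  props_finite : ∀ i r, (e.props i r).Finite
  /-- Messages to sleeping validators are queued. -/
  asleep : ∀ i r, e.env.Honest i (r + 1) → ¬ e.env.awake i (r + 1) →
    e.votes i (r + 1) = e.votes i r ∧ e.props i (r + 1) = e.props i r
  /-- Votes inside a received proposal are received. -/
  embedded : ∀ i r, ∀ m ∈ e.props i r, m.quorum ⊆ e.votes i r
  deliver_votes : ∀ i r j r', e.env.Honest i r → e.env.Running j r' → r + Δ ≤ r' →
    e.sentVotes i r ⊆ e.votes j r'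
  deliver_props : ∀ i r j r', e.env.Honest i r → e.env.Running j r' → r + Δ ≤ r' →
    e.sentProps i r ⊆ e.props j r'
  /-- Running validators gossip the votes that they have received. -/
  gossip_votes : ∀ i r j r', e.env.Running i r → e.env.Running j r' → r + Δ ≤ r' →
    e.votes i r ⊆ e.votes j r'
  /-- Received proposals are gossiped only during the first `Δ` rounds of their slot. -/
  gossip_props : ∀ i r j r', e.env.Running i r → e.env.Running j r' → r + Δ ≤ r' →
    ∀ m ∈ e.props i r, proposing Δ m.slot ≤ r → r < proposing Δ m.slot + Δ → m ∈ e.props j r'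
  /-- Messages of validators that are still honest were sent by them in an earlier round. -/
  authentic_votes : ∀ i r, e.env.Honest i r → ∀ m ∈ e.votes i r, e.env.Honest m.sender r →
    ∃ r' < r, m ∈ e.sentVotes m.sender r'
  authentic_props : ∀ i r, e.env.Honest i r → ∀ m ∈ e.props i r, e.env.Honest m.sender r →
    ∃ r' < r, m ∈ e.sentProps m.sender r'

/-- `D` is an admissible value of `Extend(C, t)`; no condition if `C.p ≥ t`. -/
def IsExtend (Δ : ℕ) (e : Execution Tx n Φ Γ σ) (C D : Chain Tx) (t : ℕ) : Prop :=
  C.p < t → C.Pre D ∧ D.p = t ∧ ∀ x ∈ e.pool (proposing Δ t), D.HasTx x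

/-- The chain `D` for which `i` may vote in slot `t` when its fork choice is `C`: a chain of
height `t` extending `C` proposed by the proposer of slot `t` if `i` has received one, and
`C` otherwise. -/
def IsVoteChoice (Δ : ℕ) (e : Execution Tx n Φ Γ σ) (i : Fin n) (t : ℕ) (C D : Chain Tx) :
    Prop :=
  let X : Set (Chain Tx) := {B | C.Pre B ∧ B.p = t ∧
    ∃ m ∈ e.props i (voting Δ t), m.slot = t ∧ m.sender = e.env.proposer t ∧ m.chain = B}
  (D ∈ X) ∨ (X = ∅ ∧ D = C)

/-- Validity of a proposal for slot `t`: it is from the proposer of slot `t`, the proposed chain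
has height `t`, and `chainC` is certified by the quorum, or is the chain `base` that needs no
certificate. -/
def ValidProposal (e : Execution Tx n Φ Γ σ) (t : ℕ) (base : Chain Tx)
    (m : Proposal Tx n Φ Γ) : Prop :=
  m.slot = t ∧ m.sender = e.env.proposer t ∧ m.chain.p = t ∧
    (m.chainC = base ∨ IsQuorum m.quorum m.chainC ((t : ℤ) - 1))

/-- The result `b` of handling the messages of `X` one after the other, in some order. -/
def HandlesAll {α β : Type} (f : β → α → β) (X : Set α) (a b : β) : Prop :=
  ∃ l : List α, l.Nodup ∧ (∀ m, m ∈ l ↔ m ∈ X) ∧ b = l.foldl f a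

end Execution

/-! ### The dynamically available protocol with fast confirmations -/

structure TobState (Tx : Type) (n : ℕ) where
  /-- The confirmed chain. -/
  conf : Chain Tx
  frozenVotes : Set (Vote Tx n Unit)
  frozenChain : Chain Tx

abbrev TobExecution (Tx : Type) (n : ℕ) := Execution Tx n Unit Unit (TobState Tx n)

namespace TobExecution

variable {Tx : Type} {n : ℕ}

def start : TobState Tx n := ⟨Chain.genesis, ∅, Chain.genesis⟩

def prev (e : TobExecution Tx n) (i : Fin n) (r : ℕ) : TobState Tx n :=
  Execution.before e start i r

open Classical in
/-- Handling a received proposal for slot `t`. -/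
def handle (e : TobExecution Tx n) (t : ℕ) (C : Chain Tx) (m : Proposal Tx n Unit Unit) :
    Chain Tx :=
  if Execution.ValidProposal e t Chain.genesis m ∧ C.Pre m.chainC then m.chainC else C

/-- The fork choice of `i` at the propose round of slot `t`. -/
def mfcPropose (Δ : ℕ) (e : TobExecution Tx n) (i : Fin n) (t : ℕ) : Chain Tx :=
  mfc (e.votes i (proposing Δ t)) (e.votes i (proposing Δ t))
    (fastConfirmSimple (e.votes i (proposing Δ t)) ((t : ℤ) - 1)).1 t

/-- The fork choice of `i` at the voting round of slot `t`. -/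
def mfcVote (Δ : ℕ) (e : TobExecution Tx n) (i : Fin n) (t : ℕ) : Chain Tx :=
  mfc (e.state i (voting Δ t)).frozenVotes (e.votes i (voting Δ t))
    (e.state i (voting Δ t)).frozenChain t

/-- The code of the protocol, as a constraint on the states and the messages of the honest
validators. Joining validators execute it without sending messages or updating the output. -/
structure Follows (Δ κ : ℕ) (e : TobExecution Tx n) : Prop where
  asleep : ∀ i r, e.env.Honest i r → ¬ e.env.awake i r → e.state i r = prev e i r
  idle : ∀ i r, e.env.Running i r → Δ < r % (4 * Δ) → r % (4 * Δ) ≠ 2 * Δ →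
    r % (4 * Δ) ≠ 3 * Δ → e.state i r = prev e i r
  /-- Proposals are handled in the rounds `4Δt, …, 4Δt + Δ`, before voting. -/
  frozen : ∀ i t r, e.env.Running i r → proposing Δ t ≤ r → r ≤ voting Δ t →
    (e.state i r).frozenVotes = (prev e i r).frozenVotes ∧
    Execution.HandlesAll (handle e t) (Execution.received e i t r r)
      (prev e i r).frozenChain (e.state i r).frozenChain
  conf_eq : ∀ i t r, e.env.Running i r → proposing Δ t ≤ r → r < voting Δ t →
    (e.state i r).conf = (prev e i r).conf
  conf_vote : ∀ i t, e.env.Running i (voting Δ t) →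
    (e.env.Active Δ i (voting Δ t) → (e.state i (voting Δ t)).conf =
      Chain.longest {C | (C = (prev e i (voting Δ t)).conf ∨
        C = (mfcVote Δ e i t).deepPrefix κ t) ∧ C.Pre (mfcVote Δ e i t)}) ∧
    (¬ e.env.Active Δ i (voting Δ t) →
      (e.state i (voting Δ t)).conf = (prev e i (voting Δ t)).conf)
  fast_confirm : ∀ i t, e.env.Running i (fastConfirming Δ t) →
    let s := prev e i (fastConfirming Δ t)
    let s' := e.state i (fastConfirming Δ t)
    let F := fastConfirmSimple (e.votes i (fastConfirming Δ t)) t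
    s'.frozenVotes = s.frozenVotes ∧ s'.frozenChain = s.frozenChain ∧
    (e.env.Active Δ i (fastConfirming Δ t) ∧ F.2 ≠ ∅ → s'.conf = F.1) ∧
    (¬ (e.env.Active Δ i (fastConfirming Δ t) ∧ F.2 ≠ ∅) → s'.conf = s.conf)
  merge : ∀ i t, e.env.Running i (merging Δ t) →
    e.state i (merging Δ t) = ⟨(prev e i (merging Δ t)).conf, e.votes i (merging Δ t),
      (fastConfirmSimple (e.votes i (merging Δ t)) t).1⟩
  propose : ∀ i t, e.env.Active Δ i (proposing Δ t) → e.env.proposer t = i →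
    let F := fastConfirmSimple (e.votes i (proposing Δ t)) ((t : ℤ) - 1)
    ∃ D, Execution.IsExtend Δ e (mfcPropose Δ e i t) D t ∧
      e.sentProps i (proposing Δ t) = {⟨D, F.1, F.2, (), t, i⟩}
  propose_only : ∀ i r, e.env.Honest i r →
    (¬ ∃ t, r = proposing Δ t ∧ e.env.Active Δ i r ∧ e.env.proposer t = i) →
    e.sentProps i r = ∅
  vote : ∀ i t, e.env.Active Δ i (voting Δ t) →
    ∃ D, Execution.IsVoteChoice Δ e i t (mfcVote Δ e i t) D ∧
      e.sentVotes i (voting Δ t) = {⟨D, (), t, i⟩}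
  vote_only : ∀ i r, e.env.Honest i r → (¬ ∃ t, r = voting Δ t ∧ e.env.Active Δ i r) →
    e.sentVotes i r = ∅

end TobExecution

/-! ### The full protocol with the finality component -/

structure FfgState (Tx : Type) (n : ℕ) where
  /-- The available chain. -/
  ava : Chain Tx
  /-- The finalized chain. -/
  fin : Chain Tx
  frozenVotes : Set (FinVote Tx n)
  frozenChain : Chain Tx
  frozenGJ : Checkpoint Tx

abbrev FfgProposal (Tx : Type) (n : ℕ) :=
  Proposal Tx n (Checkpoint Tx × Checkpoint Tx) (Checkpoint Tx)

abbrev FfgExecution (Tx : Type) (n : ℕ) :=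
  Execution Tx n (Checkpoint Tx × Checkpoint Tx) (Checkpoint Tx) (FfgState Tx n)

namespace FfgExecution

variable {Tx : Type} {n : ℕ}

def start : FfgState Tx n :=
  ⟨Chain.genesis, Chain.genesis, ∅, Chain.genesis, genesisCheckpoint⟩

def prev (e : FfgExecution Tx n) (i : Fin n) (r : ℕ) : FfgState Tx n :=
  Execution.before e start i r

open Classical in
/-- Handling a received proposal for slot `t` with view `V` at the voting round; the state
handled is the pair of the frozen chain and the frozen greatest justified checkpoint. -/
def handle (e : FfgExecution Tx n) (t : ℕ) (V : Set (FinVote Tx n))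
    (a : Chain Tx × Checkpoint Tx) (m : FfgProposal Tx n) : Chain Tx × Checkpoint Tx :=
  if Execution.ValidProposal e t m.gj.chain m ∧ Justified V m.gj ∧
      (m.gj = a.2 ∨ a.2.c < m.gj.c) then
    let C : Chain Tx := if m.gj.chain.Pre a.1 then a.1 else m.gj.chain
    (if C.Pre m.chainC then m.chainC else C, m.gj)
  else a

/-- The fork choice of `i` at the propose round of slot `t`. -/
def mfcPropose (Δ : ℕ) (e : FfgExecution Tx n) (i : Fin n) (t : ℕ) : Chain Tx :=
  mfc (e.votes i (proposing Δ t)) (e.votes i (proposing Δ t))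
    (fastConfirm (e.votes i (proposing Δ t)) ((t : ℤ) - 1)).1 t

/-- The fork choice of `i` at the voting round of slot `t`. -/
def mfcVote (Δ : ℕ) (e : FfgExecution Tx n) (i : Fin n) (t : ℕ) : Chain Tx :=
  mfc (e.state i (voting Δ t)).frozenVotes (e.votes i (voting Δ t))
    (e.state i (voting Δ t)).frozenChain t

open Classical in
/-- The target checkpoint of the finality vote of `i` in slot `t`. -/
def target (Δ : ℕ) (e : FfgExecution Tx n) (i : Fin n) (t : ℕ) : Checkpoint Tx :=
  let s := e.state i (voting Δ t)
  if s.frozenGJ.c + 1 = t then ⟨s.ava, t⟩ else ⟨s.frozenGJ.chain, t⟩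

/-- The code of the protocol, as a constraint on the states and the messages of the honest
validators. Joining validators execute it without sending messages or updating the outputs. -/
structure Follows (Δ κ : ℕ) (e : FfgExecution Tx n) : Prop where
  asleep : ∀ i r, e.env.Honest i r → ¬ e.env.awake i r → e.state i r = prev e i r
  idle : ∀ i r, e.env.Running i r → r % (4 * Δ) ≠ Δ → r % (4 * Δ) ≠ 2 * Δ →
    r % (4 * Δ) ≠ 3 * Δ → e.state i r = prev e i r
  /-- Proposals received in the rounds `4Δt, …, 4Δt + Δ` are handled at the voting round,
  before voting. -/
  frozen : ∀ i t, e.env.Running i (voting Δ t) →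
    let s := prev e i (voting Δ t)
    let s' := e.state i (voting Δ t)
    s'.frozenVotes = s.frozenVotes ∧
    Execution.HandlesAll (handle e t (e.votes i (voting Δ t)))
      (Execution.received e i t (proposing Δ t) (voting Δ t))
      (s.frozenChain, s.frozenGJ) (s'.frozenChain, s'.frozenGJ)
  out_vote : ∀ i t, e.env.Running i (voting Δ t) →
    let s := prev e i (voting Δ t)
    let s' := e.state i (voting Δ t)
    (e.env.Active Δ i (voting Δ t) →
      s'.ava = Chain.longest {C | (C = s.ava ∨ C = (mfcVote Δ e i t).deepPrefix κ t ∨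
        C = s'.frozenGJ.chain) ∧ C.Pre (mfcVote Δ e i t)} ∧
      s'.fin = Chain.longest {C | C.Pre s'.ava ∧
        C.Pre (gfOf (e.votes i (voting Δ t))).chain}) ∧
    (¬ e.env.Active Δ i (voting Δ t) → s'.ava = s.ava ∧ s'.fin = s.fin)
  fast_confirm : ∀ i t, e.env.Running i (fastConfirming Δ t) →
    let s := prev e i (fastConfirming Δ t)
    let s' := e.state i (fastConfirming Δ t)
    let V := e.votes i (fastConfirming Δ t)
    s'.frozenVotes = s.frozenVotes ∧ s'.frozenChain = s.frozenChain ∧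
      s'.frozenGJ = s.frozenGJ ∧
    (e.env.Active Δ i (fastConfirming Δ t) →
      (¬ (fastConfirm V t).1.Pre s.ava → s'.ava = (fastConfirm V t).1) ∧
      ((fastConfirm V t).1.Pre s.ava → s'.ava = s.ava) ∧
      s'.fin = (gfOf V).chain) ∧
    (¬ e.env.Active Δ i (fastConfirming Δ t) → s'.ava = s.ava ∧ s'.fin = s.fin)
  merge : ∀ i t, e.env.Running i (merging Δ t) →
    let s := prev e i (merging Δ t)
    let V := e.votes i (merging Δ t)
    e.state i (merging Δ t) = ⟨s.ava, s.fin, V, (fastConfirm V t).1, gjOf V⟩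
  propose : ∀ i t, e.env.Active Δ i (proposing Δ t) → e.env.proposer t = i →
    let V := e.votes i (proposing Δ t)
    let F := fastConfirm V ((t : ℤ) - 1)
    ∃ D, Execution.IsExtend Δ e (mfcPropose Δ e i t) D t ∧
      e.sentProps i (proposing Δ t) = {⟨D, F.1, F.2, gjOf V, t, i⟩}
  propose_only : ∀ i r, e.env.Honest i r →
    (¬ ∃ t, r = proposing Δ t ∧ e.env.Active Δ i r ∧ e.env.proposer t = i) →
    e.sentProps i r = ∅
  vote : ∀ i t, e.env.Active Δ i (voting Δ t) →
    ∃ D, Execution.IsVoteChoice Δ e i t (mfcVote Δ e i t) D ∧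
      e.sentVotes i (voting Δ t) =
        {⟨D, ((e.state i (voting Δ t)).frozenGJ, target Δ e i t), t, i⟩}
  vote_only : ∀ i r, e.env.Honest i r → (¬ ∃ t, r = voting Δ t ∧ e.env.Active Δ i r) →
    e.sentVotes i r = ∅

end FfgExecution

/-! ### Security notions -/

section Security

variable {Tx : Type} {n : ℕ} {Φ Γ σ : Type}

/-- Reorg resilience in the first `T` slots, for the output chains `out i r`: a chain proposed
in slot `t` by a validator honest in round `4Δt` never conflicts with the output of a validator
`i` honest in round `r`. -/
def ReorgResilient (Δ T : ℕ) (e : Execution Tx n Φ Γ σ) (out : Fin n → ℕ → Chain Tx) : Prop :=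
  ∀ t < T, ∀ k, e.env.Honest k (proposing Δ t) → ∀ m ∈ e.sentProps k (proposing Δ t),
    ∀ r < 4 * Δ * T, ∀ i, e.env.Honest i r → ¬ m.chain.Conflict (out i r)

/-- In the first `T` slots, the output of a validator honest in round `r` is a prefix of
the fork choice of every validator active in a later propose or voting round. -/
def OutputsCanonical (Δ T : ℕ) (e : Execution Tx n Φ Γ σ) (out mfcP mfcV : Fin n → ℕ → Chain Tx) :
    Prop :=
  ∀ r i, e.env.Honest i r → ∀ t < T, ∀ j,
    (r ≤ proposing Δ t → e.env.Active Δ j (proposing Δ t) → (out i r).Pre (mfcP j t)) ∧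
    (r ≤ voting Δ t → e.env.Active Δ j (voting Δ t) → (out i r).Pre (mfcV j t))

/-- Fair and unpredictable proposer election against an adaptive adversary. `ℱ t` is the
information available before the proposer of slot `t` is revealed. It comprises the earlier
proposers and the set of validators active at round `4Δt`. -/
structure FairElection {Ω : Type} [mΩ : MeasurableSpace Ω] (Δ : ℕ) (μ : Measure Ω)
    (ℱ : Filtration ℕ mΩ) (env : Ω → Env n) : Prop where
  uniform : ∀ t k, μ {ω | (env ω).proposer t = k} = (n : ℝ≥0∞)⁻¹
  unpredictable : ∀ t k (B : Set Ω), MeasurableSet[ℱ t] B →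
    μ (B ∩ {ω | (env ω).proposer t = k}) = μ B * μ {ω | (env ω).proposer t = k}
  revealed : ∀ t k, MeasurableSet[ℱ (t + 1)] {ω | (env ω).proposer t = k}
  activity : ∀ t k, MeasurableSet[ℱ t] {ω | (env ω).Active Δ k (proposing Δ t)}

end Security

end Sleepy

end

/-!
Reorg resilience rests on three facts about fork choices.

*Unanimity persists.* If all active validators vote in slot `s` for extensions of `B`, then by the
sleepiness condition those of them that stay honest outnumber all other voters of slot `s + 1`, so
that `B` has a majority in every view (`Execution.VotesOnce.hasMajority`) and is a prefix of every
fork choice of slot `s + 1`, provided that the chain from which the fork choice starts does not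
conflict with `B` (`Backbone.Lawful.pre_forks_of_lt`).

*A slot with an active proposer is a pivot.* A voter's majority lies between the votes frozen one
`Δ` before the proposal and the votes received one `Δ` after it. The proposer has a view in between,
hence sees the same majority and proposes an extension of every voter's fork choice, for which
all active validators then vote (`HasMajority.of_between`, `Backbone.Lawful.votesExtend_proposal`).

*Fast confirmations lock.* A quorum seen at the fast-confirmation round is known to everybody when
the votes are frozen, two quorums share an honest vote, and so every fork choice of the next slot
starts from an extension of the fast-confirmed chain.

Consequently an output is a prefix of all later fork choices: a fast-confirmed chain by the third
fact, and a `κ`-deep prefix because, if one of the preceding `κ` slots was a pivot, it is a prefix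
of the chain proposed there (`Backbone.Lawful.out_pre_forks`). A proposed chain and an output are
then both prefixes of a common later fork choice, so they do not conflict.

With finality, a fork choice may also start from a justified chain. Such a chain is an output of an
honest voter of an earlier slot, or was already justified in the view of one. Whether justified
chains are harmless therefore depends on outputs of earlier slots only, whose safety depends on
justified chains of yet earlier slots; `Backbone.Lawful.anchored` is the induction over slots that
resolves this. Justified chains may get shorter as their slots grow, but being extended by all
recent votes they are prefixes of the fork choice of the proposer, which is what a pivot needs.

Both protocols are treated at once: `Backbone.Lawful` lists the properties that the argument uses,
and `TobExecution.Follows.lawful` and `FfgExecution.Follows.lawful` establish them.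

Finally, given the past, the proposer of a slot is inactive with probability at most `1 - h / n`,
and a union bound over the windows of `κ` slots gives the probability that some window has no
pivot (`FairElection.measure_not_pivotal_le`).
-/

namespace Sleepy

/-! ### Chains -/

namespace Chain

variable {Tx : Type} {C D E : Chain Tx}

theorem Pre.refl (C : Chain Tx) : C.Pre C := List.prefix_rfl

theorem Pre.trans (h₁ : C.Pre D) (h₂ : D.Pre E) : C.Pre E := List.IsPrefix.trans h₁ h₂

theorem genesis_pre (C : Chain Tx) : genesis.Pre C := List.nil_prefix

theorem Pre.eq_genesis (h : C.Pre genesis) : C = genesis :=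
  Chain.ext (List.prefix_nil.mp h)

/-- One of the two chains is a prefix of the other. -/
def Compatible (C D : Chain Tx) : Prop := C.Pre D ∨ D.Pre C

theorem Compatible.symm (h : Compatible C D) : Compatible D C := Or.symm h

theorem Pre.compatible (h₁ : C.Pre E) (h₂ : D.Pre E) : Compatible C D :=
  List.prefix_or_prefix_of_prefix h₁ h₂

theorem p_genesis : (genesis : Chain Tx).p = -1 := rfl

theorem Pre.eq_or_p_lt (h : C.Pre D) : C = D ∨ C.p < D.p := by
  obtain ⟨l, hl⟩ := h
  rcases List.eq_nil_or_concat l with rfl | ⟨l', b, rfl⟩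
  · left
    exact Chain.ext (by simpa using hl)
  · right
    have hD : D.p = b.slot := by
      unfold p
      rw [← hl]
      simp
    rw [hD]
    unfold p
    split
    · omega
    · rename_i a ha
      have hinc := D.increasing
      rw [← hl, List.pairwise_append] at hinc
      have := hinc.2.2 a (List.mem_of_getLast? ha) b (by simp)
      exact_mod_cast this

theorem Pre.p_le (h : C.Pre D) : C.p ≤ D.p := by
  rcases h.eq_or_p_lt with rfl | h
  · exact le_rfl
  · exact h.le

theorem Compatible.pre_of_p_le (h : Compatible C D) (hp : C.p ≤ D.p) : C.Pre D := by
  rcases h with h | h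
  · exact h
  · rcases h.eq_or_p_lt with rfl | h'
    · exact Pre.refl _
    · omega

theorem eq_genesis_of_p_neg (h : C.p < 0) : C = genesis := by
  rcases (genesis_pre C).eq_or_p_lt with h' | h'
  · exact h'.symm
  · rw [p_genesis] at h'
    omega

theorem longest_spec {X : Set (Chain Tx)} (hX : X.Nonempty) {N : ℤ} (hN : ∀ C ∈ X, C.p ≤ N) :
    longest X ∈ X ∧ ∀ D ∈ X, D.p ≤ (longest X).p := by
  have key : ∃ C ∈ X, ∀ D ∈ X, D.p ≤ C.p := by
    obtain ⟨z, ⟨C, hC, rfl⟩, hz⟩ := Int.exists_greatest_of_bdd (P := fun z => ∃ C ∈ X, C.p = z)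
      ⟨N, fun z ⟨C, hC, hz⟩ => hz ▸ hN C hC⟩ (hX.elim fun C hC => ⟨C.p, C, hC, rfl⟩)
    exact ⟨C, hC, fun D hD => hz _ ⟨D, hD, rfl⟩⟩
  unfold longest
  rw [dif_pos key]
  exact key.choose_spec

theorem deepPrefix_spec (C : Chain Tx) (κ t : ℕ) :
    (C.deepPrefix κ t).Pre C ∧
      (C.deepPrefix κ t = genesis ∨ (C.deepPrefix κ t).p ≤ (t : ℤ) - κ) := by
  by_cases h : {D : Chain Tx | D.Pre C ∧ D.p ≤ (t : ℤ) - κ}.Nonempty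
  · have := (longest_spec h (fun D hD => hD.2)).1
    exact ⟨this.1, Or.inr this.2⟩
  · have hg : C.deepPrefix κ t = genesis := by
      unfold deepPrefix longest
      rw [dif_neg]
      rintro ⟨D, hD, -⟩
      exact h ⟨D, hD⟩
    rw [hg]
    exact ⟨genesis_pre C, Or.inl rfl⟩

end Chain

open Chain (Compatible Pre)

/-! ### Majority fork choice and fast confirmation -/

section ForkChoice

variable {Tx : Type} {n : ℕ} {Φ : Type} {U V W V' : Set (Vote Tx n Φ)} {C D : Chain Tx}
  {t : ℕ} {s : ℤ}

theorem voters_mono (h : V ⊆ W) : voters V ⊆ voters W :=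
  fun _ ⟨m, hm, hk⟩ => ⟨m, h hm, hk⟩

theorem slotVotes_mono (h : V ⊆ W) : slotVotes V C s ⊆ slotVotes W C s :=
  fun _ hm => ⟨h hm.1, hm.2⟩

theorem IsQuorum.mono (h : V ⊆ W) (hq : IsQuorum V C s) : IsQuorum W C s :=
  le_trans hq (Nat.mul_le_mul_left 3
    (Set.ncard_le_ncard (voters_mono (slotVotes_mono h)) (Set.toFinite _)))

/-- The acceptance condition of `mfc` for proper extensions of its starting chain. -/
def HasMajority (V V' : Set (Vote Tx n Φ)) (D : Chain Tx) (t : ℕ) : Prop :=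
  (voters (filExp V' t)).ncard < 2 * (voters (support V D t ∩ support V' D t)).ncard

theorem HasMajority.exists_mem (h : HasMajority V V' D t) :
    ∃ m, m ∈ support V D t ∧ m ∈ support V' D t := by
  have hpos : 0 < (voters (support V D t ∩ support V' D t)).ncard := by
    unfold HasMajority at h
    omega
  obtain ⟨k, m, hm, -⟩ := (Set.ncard_pos (Set.toFinite _)).mp hpos
  exact ⟨m, hm⟩

theorem support_subset (V : Set (Vote Tx n Φ)) (D : Chain Tx) (t : ℕ) :
    support V D t ⊆ filExp V t :=
  fun _ hm => ⟨hm.1.1.1.1, hm.1.1.2⟩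

/-- Two majorities share a validator, whose latest vote extends both chains. -/
theorem HasMajority.compatible (hC : HasMajority V V' C t) (hD : HasMajority V V' D t) :
    Compatible C D := by
  have hsub : ∀ X : Chain Tx,
      voters (support V X t ∩ support V' X t) ⊆ voters (filExp V' t) := fun X =>
    voters_mono fun m hm => support_subset V' X t hm.2
  have hu := Set.ncard_le_ncard (Set.union_subset (hsub C) (hsub D)) (Set.toFinite _)
  have hi := Set.ncard_union_add_ncard_inter (voters (support V C t ∩ support V' C t))
    (voters (support V D t ∩ support V' D t)) (Set.toFinite _) (Set.toFinite _)
  unfold HasMajority at hC hD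
  have hpos : 0 < (voters (support V C t ∩ support V' C t) ∩
    voters (support V D t ∩ support V' D t)).ncard := by omega
  obtain ⟨k, ⟨m, hm, hmk⟩, m', hm', hmk'⟩ := (Set.ncard_pos (Set.toFinite _)).mp hpos
  have hs : m.slot = m'.slot := le_antisymm
    (hm'.2.1.2 m hm.2.1.1 (hmk.trans hmk'.symm)) (hm.2.1.2 m' hm'.2.1.1 (hmk'.trans hmk.symm))
  have hc : m.chain = m'.chain := by
    by_contra hne
    exact hm.2.1.1.1.2 ⟨m, hm.2.1.1.1.1, m', hm'.2.1.1.1.1, rfl, hmk'.trans hmk.symm, hs, hne⟩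
  exact Pre.compatible hm.2.2 (hc ▸ hm'.2.2)

/-- A majority that holds between an older view `U` and a newer view `W` is also seen by every
view `V` in between: equivocations and newer votes known to `V` are known to `W`. -/
theorem HasMajority.of_between (hUV : U ⊆ V) (hVW : V ⊆ W) (h : HasMajority U W D t) :
    HasMajority V V D t := by
  have h₁ : (voters (filExp V t)).ncard ≤ (voters (filExp W t)).ncard :=
    Set.ncard_le_ncard (voters_mono fun m hm => ⟨hVW hm.1, hm.2⟩) (Set.toFinite _)
  have h₂ : support U D t ∩ support W D t ⊆ support V D t ∩ support V D t := by
    rintro m ⟨hU, hW⟩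
    have hne : ¬ Equivocates V m.sender := fun ⟨a, ha, b, hb, hab⟩ =>
      hW.1.1.1.2 ⟨a, hVW ha, b, hVW hb, hab⟩
    have : m ∈ support V D t := by
      refine ⟨⟨⟨⟨hUV hU.1.1.1.1, hne⟩, hU.1.1.2⟩, fun m' hm' hs => ?_⟩, hU.2⟩
      refine hW.1.2 m' ⟨⟨hVW hm'.1.1, ?_⟩, hm'.2⟩ hs
      rw [hs]
      exact hW.1.1.1.2
    exact ⟨this, this⟩
  have h₃ := Set.ncard_le_ncard (voters_mono h₂) (Set.toFinite _)
  unfold HasMajority at h ⊢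
  omega

theorem mfc_spec (hV' : V'.Finite) :
    C.Pre (mfc V V' C t) ∧ (mfc V V' C t = C ∨ HasMajority V V' (mfc V V' C t) t) ∧
      ∀ D, C.Pre D → HasMajority V V' D t → D.p ≤ (mfc V V' C t).p := by
  obtain ⟨N, hN⟩ := (hV'.image fun m => m.chain.p).bddAbove
  have := Chain.longest_spec (X := {D | C.Pre D ∧ (D = C ∨
      (voters (filExp V' t)).ncard < 2 * (voters (support V D t ∩ support V' D t)).ncard)})
    ⟨C, Pre.refl C, Or.inl rfl⟩ (N := max C.p N) (by
      rintro D ⟨-, rfl | hD⟩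
      · exact le_max_left _ _
      · obtain ⟨m, -, hm⟩ := HasMajority.exists_mem hD
        exact le_max_of_le_right (hm.2.p_le.trans (hN ⟨m, hm.1.1.1.1, rfl⟩)))
  exact ⟨this.1.1, this.1.2, fun D h₁ h₂ => this.2 D ⟨h₁, Or.inr h₂⟩⟩

theorem HasMajority.pre_mfc (hV' : V'.Finite) (hD : HasMajority V V' D t)
    (hCD : Compatible C D) : D.Pre (mfc V V' C t) := by
  obtain ⟨h₁, h₂, h₃⟩ := mfc_spec (V := V) (C := C) (t := t) hV'
  rcases hCD with hCD | hDC
  · refine Compatible.pre_of_p_le ?_ (h₃ D hCD hD)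
    rcases h₂ with h₂ | h₂
    · rw [h₂]
      exact Or.inr hCD
    · exact hD.compatible h₂
  · exact hDC.trans h₁

theorem IsQuorum.exists_mem (hn : 0 < n) (h : IsQuorum V C s) : ∃ m, m ∈ slotVotes V C s := by
  have hpos : 0 < (voters (slotVotes V C s)).ncard := by
    unfold IsQuorum at h
    omega
  obtain ⟨k, m, hm, -⟩ := (Set.ncard_pos (Set.toFinite _)).mp hpos
  exact ⟨m, hm⟩

theorem fastConfirmSimple_of_quorum (hn : 0 < n) (hV : V.Finite) (hC : IsQuorum V C s) :
    IsQuorum V (fastConfirmSimple V s).1 s ∧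
      (fastConfirmSimple V s).2 = slotVotes V (fastConfirmSimple V s).1 s ∧
      C.p ≤ (fastConfirmSimple V s).1.p := by
  obtain ⟨N, hN⟩ := (hV.image fun m => m.chain.p).bddAbove
  have hne : {C : Chain Tx | IsQuorum V C s}.Nonempty := ⟨C, hC⟩
  have := Chain.longest_spec hne (N := N) (by
    intro D hD
    obtain ⟨m, hm⟩ := IsQuorum.exists_mem hn hD
    exact hm.2.1.p_le.trans (hN ⟨m, hm.1, rfl⟩))
  unfold fastConfirmSimple
  rw [if_pos hne]
  exact ⟨this.1, rfl, this.2 C hC⟩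

theorem fastConfirmSimple_cases (hn : 0 < n) (hV : V.Finite) :
    (IsQuorum V (fastConfirmSimple V s).1 s ∧
      (fastConfirmSimple V s).2 = slotVotes V (fastConfirmSimple V s).1 s) ∨
    fastConfirmSimple V s = (Chain.genesis, ∅) := by
  by_cases h : ∃ C, IsQuorum V C s
  · obtain ⟨C, hC⟩ := h
    have := fastConfirmSimple_of_quorum hn hV hC
    exact Or.inl ⟨this.1, this.2.1⟩
  · right
    unfold fastConfirmSimple
    rw [if_neg]
    exact h

theorem isQuorum_slotVotes (h : IsQuorum V C s) : IsQuorum (slotVotes V C s) C s := by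
  have : slotVotes (slotVotes V C s) C s = slotVotes V C s :=
    Set.ext fun m => ⟨fun hm => hm.1, fun hm => ⟨hm, hm.2⟩⟩
  unfold IsQuorum
  rwa [this]

end ForkChoice

/-! ### Rounds, activity, and quorum intersection -/

section Rounds

variable {Δ s t : ℕ}

theorem proposing_le_proposing (h : s ≤ t) : proposing Δ s ≤ proposing Δ t :=
  Nat.mul_le_mul_left _ h

theorem proposing_succ (Δ t : ℕ) : proposing Δ (t + 1) = proposing Δ t + 4 * Δ :=
  Nat.mul_succ _ _

theorem proposing_add_le (h : s < t) : proposing Δ s + 4 * Δ ≤ proposing Δ t := by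
  rw [← proposing_succ]
  exact proposing_le_proposing h

theorem voting_eq (Δ t : ℕ) : voting Δ t = proposing Δ t + Δ := rfl

theorem fastConfirming_eq (Δ t : ℕ) : fastConfirming Δ t = proposing Δ t + 2 * Δ := rfl

theorem merging_eq (Δ t : ℕ) : merging Δ t = proposing Δ t + 3 * Δ := rfl

theorem voting_le_voting (h : s ≤ t) : voting Δ s ≤ voting Δ t :=
  Nat.add_le_add_right (proposing_le_proposing h) _

theorem merging_le_proposing (s : ℕ) : merging Δ s ≤ proposing Δ (s + 1) := by
  rw [merging_eq, proposing_succ]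
  omega

theorem lt_of_voting_lt_voting (h : voting Δ s < voting Δ t) : s < t := by
  by_contra hts
  exact absurd (voting_le_voting (Δ := Δ) (not_lt.mp hts)) (not_le.mpr h)

theorem voting_injective (hΔ : 0 < Δ) (h : voting Δ s = voting Δ t) : s = t := by
  rcases lt_trichotomy s t with hst | hst | hst
  · have := proposing_add_le (Δ := Δ) hst
    simp only [voting_eq] at h
    omega
  · exact hst
  · have := proposing_add_le (Δ := Δ) hst
    simp only [voting_eq] at h
    omega

theorem proposing_injective (hΔ : 0 < Δ) (h : proposing Δ s = proposing Δ t) : s = t :=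
  voting_injective hΔ (congrArg (· + Δ) h)

/-- Every round is at some offset within some slot. -/
theorem exists_round_eq (hΔ : 0 < Δ) (r : ℕ) :
    ∃ t q, q < 4 * Δ ∧ r = proposing Δ t + q ∧ r % (4 * Δ) = q :=
  ⟨r / (4 * Δ), r % (4 * Δ), Nat.mod_lt _ (by omega), (Nat.div_add_mod r (4 * Δ)).symm, rfl⟩

theorem proposing_add_mod {q : ℕ} (hq : q < 4 * Δ) : (proposing Δ t + q) % (4 * Δ) = q := by
  unfold proposing
  rw [Nat.mul_add_mod, Nat.mod_eq_of_lt hq]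

end Rounds

namespace Env

variable {n Δ : ℕ} {E : Env n} {i : Fin n} {r r' s : ℕ}

theorem Honest.of_le (h : E.Honest i r') (hr : r ≤ r') : E.Honest i r :=
  fun hc => h (E.corrupted_mono hr hc)

theorem Active.running (h : E.Active Δ i r) : E.Running i r := by
  refine ⟨h.1, ?_⟩
  rcases h.2 with h' | ⟨t, ht, h'⟩
  · exact h' r le_rfl
  · refine h' r ?_ le_rfl
    rw [voting_eq] at *
    rw [proposing_succ] at ht
    omega

theorem Active.running_of_merging_le (h : E.Active Δ i (voting Δ (s + 1)))
    (hr : merging Δ s ≤ r) (hr' : r ≤ voting Δ (s + 1)) : E.Running i r := by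
  refine ⟨h.1.of_le hr', ?_⟩
  rcases h.2 with h' | ⟨t, ht, h'⟩
  · exact h' r hr'
  · refine h' r ?_ hr'
    by_contra hlt
    have hts : s < t := by
      by_contra hts
      have := proposing_le_proposing (Δ := Δ) (not_lt.mp hts)
      simp only [voting_eq, merging_eq] at *
      omega
    have := proposing_add_le (Δ := Δ) hts
    simp only [voting_eq, merging_eq, proposing_succ] at *
    omega

theorem Active.running_of_le (hΔ : 0 < Δ) (h : E.Active Δ i (voting Δ 0))
    (hr : r ≤ voting Δ 0) : E.Running i r := by
  refine ⟨h.1.of_le hr, ?_⟩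
  rcases h.2 with h' | ⟨t, ht, -⟩
  · exact h' r hr
  · have := proposing_add_le (Δ := Δ) (s := 0) (t := t + 1) (Nat.succ_pos t)
    simp only [voting_eq] at *
    omega

/-- An active validator of a voting round has been running since the start of the slot. -/
theorem Active.running_of_proposing_le (hΔ : 0 < Δ) {t : ℕ} (h : E.Active Δ i (voting Δ t))
    (hr : proposing Δ t ≤ r) (hr' : r ≤ voting Δ t) : E.Running i r := by
  cases t with
  | zero => exact h.running_of_le hΔ hr'
  | succ s =>
    refine h.running_of_merging_le ?_ hr'
    rw [merging_eq]
    rw [proposing_succ] at hr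
    omega

theorem Compliant.pos (h : E.Compliant Δ) : 0 < n := lt_of_le_of_lt (Nat.zero_le _) h.few_corrupted

/-- Two sets of two thirds of the validators share a validator that is never corrupted. -/
theorem Compliant.exists_honest (h : E.Compliant Δ) {Q Q' : Set (Fin n)}
    (hQ : 2 * n ≤ 3 * Q.ncard) (hQ' : 2 * n ≤ 3 * Q'.ncard) :
    ∃ k, k ∈ Q ∧ k ∈ Q' ∧ ∀ r, E.Honest k r := by
  by_contra! hc
  have hsub : Q ∩ Q' ⊆ ⋃ r, E.corrupted r := by
    rintro k ⟨hk, hk'⟩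
    obtain ⟨r, hr⟩ := hc k hk hk'
    exact Set.mem_iUnion.mpr ⟨r, not_not.mp hr⟩
  have h₁ := Set.ncard_le_ncard hsub (Set.toFinite _)
  have h₂ := Set.ncard_union_add_ncard_inter Q Q' (Set.toFinite _) (Set.toFinite _)
  have h₃ : (Q ∪ Q').ncard ≤ n := by
    simpa using Set.ncard_le_card (Q ∪ Q')
  have h₄ := h.few_corrupted
  omega

theorem Compliant.exists_active (h : E.Compliant Δ) (s : ℕ) : ∃ i, E.Active Δ i (voting Δ s) := by
  have hs := h.sleepiness s
  obtain ⟨i, hi⟩ := (Set.ncard_pos (Set.toFinite _)).mp (lt_of_le_of_lt (Nat.zero_le _) hs)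
  exact ⟨i, hi.1⟩

end Env

/-! ### The common backbone of the two protocols -/

/-- What the reorg-resilience argument needs to see of an execution. `frozenVotes i t` is the
frozen vote set with which `i` votes in slot `t`; `baseP i t` and `baseV i t` are the chains from
which its fork choice starts at the propose and the voting round of slot `t`; `anchor t` comprises
the chains that may serve as such a starting chain without a quorum of slot `t - 1`. -/
structure Backbone (Tx : Type) (n : ℕ) (Φ Γ σ : Type) where
  e : Execution Tx n Φ Γ σ
  out : Fin n → ℕ → Chain Tx
  frozenVotes : Fin n → ℕ → Set (Vote Tx n Φ)
  baseP : Fin n → ℕ → Chain Tx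
  baseV : Fin n → ℕ → Chain Tx
  anchor : ℕ → Set (Chain Tx)

namespace Backbone

variable {Tx : Type} {n : ℕ} {Φ Γ σ : Type} {Δ κ T : ℕ}

section Definitions

variable (Δ : ℕ) (b : Backbone Tx n Φ Γ σ)

/-- The fork choice of `i` at the propose round of slot `t`. -/
noncomputable def forkP (i : Fin n) (t : ℕ) : Chain Tx :=
  mfc (b.e.votes i (proposing Δ t)) (b.e.votes i (proposing Δ t)) (b.baseP i t) t

/-- The fork choice of `i` at the voting round of slot `t`. -/
noncomputable def forkV (i : Fin n) (t : ℕ) : Chain Tx :=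
  mfc (b.frozenVotes i t) (b.e.votes i (voting Δ t)) (b.baseV i t) t

/-- The chains from which a fork choice of slot `t` may start: anchors, and chains with a quorum
of slot `t - 1` in an honest view. -/
def Candidate (t : ℕ) (X : Chain Tx) : Prop :=
  X ∈ b.anchor t ∨ ∃ j r, b.e.env.Honest j r ∧ r ≤ voting Δ t ∧
    IsQuorum (b.e.votes j r) X ((t : ℤ) - 1)

/-- All active validators vote in slot `s` for extensions of `B`. -/
def VotesExtend (s : ℕ) (B : Chain Tx) : Prop :=
  ∀ i, b.e.env.Active Δ i (voting Δ s) → ∀ m ∈ b.e.sentVotes i (voting Δ s), B.Pre m.chain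

/-- Every anchor of slot `t` was extended by all votes that active validators cast in the
preceding slot. -/
def Anchored (t : ℕ) : Prop :=
  ∀ G ∈ b.anchor t, G = Chain.genesis ∨ ∃ s, t = s + 1 ∧ b.VotesExtend Δ s G

def CandidatesCompatible (t : ℕ) : Prop :=
  ∀ X Y, b.Candidate Δ t X → b.Candidate Δ t Y → Compatible X Y

end Definitions

/-- The properties of an execution on which the reorg-resilience argument rests. -/
structure Lawful (Δ κ : ℕ) (b : Backbone Tx n Φ Γ σ) : Prop where
  pos : 0 < Δ
  compliant : b.e.env.Compliant Δ
  synchronous : Execution.Synchronous Δ b.e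
  frozen_zero : ∀ i, b.e.env.Active Δ i (voting Δ 0) → b.frozenVotes i 0 = ∅
  frozen_succ : ∀ i s, b.e.env.Active Δ i (voting Δ (s + 1)) →
    b.frozenVotes i (s + 1) = b.e.votes i (merging Δ s)
  vote : ∀ i t, b.e.env.Active Δ i (voting Δ t) →
    ∃ D φ, Execution.IsVoteChoice Δ b.e i t (b.forkV Δ i t) D ∧
      b.e.sentVotes i (voting Δ t) = {⟨D, φ, t, i⟩}
  vote_only : ∀ i r, b.e.env.Honest i r → (¬ ∃ t, r = voting Δ t ∧ b.e.env.Active Δ i r) →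
    b.e.sentVotes i r = ∅
  propose : ∀ i t, b.e.env.Active Δ i (proposing Δ t) → b.e.env.proposer t = i →
    ∃ m, Execution.IsExtend Δ b.e (b.forkP Δ i t) m.chain t ∧ m.slot = t ∧ m.sender = i ∧
      b.e.sentProps i (proposing Δ t) = {m}
  propose_only : ∀ i r, b.e.env.Honest i r →
    (¬ ∃ t, r = proposing Δ t ∧ b.e.env.Active Δ i r ∧ b.e.env.proposer t = i) →
    b.e.sentProps i r = ∅
  baseP_candidate : ∀ i t, b.e.env.Active Δ i (proposing Δ t) → b.Candidate Δ t (b.baseP i t)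
  baseV_candidate : ∀ i t, b.e.env.Active Δ i (voting Δ t) → b.Candidate Δ t (b.baseV i t)
  /-- A quorum seen at the fast-confirmation round is respected by the next propose round. -/
  lockP : ∀ s, b.CandidatesCompatible Δ (s + 1) → ∀ i, b.e.env.Running i (fastConfirming Δ s) →
    ∀ C, IsQuorum (b.e.votes i (fastConfirming Δ s)) C s →
    ∀ j, b.e.env.Active Δ j (proposing Δ (s + 1)) → C.Pre (b.baseP j (s + 1))
  /-- A quorum seen at the fast-confirmation round is respected by the next voting round. -/
  lockV : ∀ s, b.CandidatesCompatible Δ (s + 1) → ∀ i, b.e.env.Running i (fastConfirming Δ s) →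
    ∀ C, IsQuorum (b.e.votes i (fastConfirming Δ s)) C s →
    ∀ j, b.e.env.Active Δ j (voting Δ (s + 1)) → C.Pre (b.baseV j (s + 1))
  /-- Voters adopt the starting chain of an active proposer, or start from a longer chain that is
  an anchor. -/
  adopt : ∀ t, b.CandidatesCompatible Δ t →
    b.e.env.Active Δ (b.e.env.proposer t) (proposing Δ t) →
    ∀ m ∈ b.e.sentProps (b.e.env.proposer t) (proposing Δ t), m.chain.p = t →
    ∀ i, b.e.env.Active Δ i (voting Δ t) → m ∈ b.e.props i (voting Δ t) →
      (b.baseP (b.e.env.proposer t) t).Pre (b.baseV i t) ∧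
      ((b.baseV i t).Pre (b.baseP (b.e.env.proposer t) t) ∨ b.baseV i t ∈ b.anchor t)
  /-- An anchor other than genesis was an output of an earlier voter, or an anchor for it. -/
  anchor_origin : ∀ t, ∀ G ∈ b.anchor t, G = Chain.genesis ∨
    ∃ s < t, ∃ k, b.e.env.Active Δ k (voting Δ s) ∧ (G = b.out k (voting Δ s) ∨ G ∈ b.anchor s)
  out_zero : ∀ i, b.e.env.Honest i 0 → b.out i 0 = Chain.genesis
  out_succ : ∀ i r, b.e.env.Honest i (r + 1) → b.out i (r + 1) = b.out i r ∨
    (∃ s, r + 1 = voting Δ s ∧ b.e.env.Active Δ i (r + 1) ∧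
      (b.out i (r + 1) = (b.forkV Δ i s).deepPrefix κ s ∨ b.out i (r + 1) ∈ b.anchor s)) ∨
    (∃ s, r + 1 = fastConfirming Δ s ∧ b.e.env.Running i (r + 1) ∧
      (IsQuorum (b.e.votes i (r + 1)) (b.out i (r + 1)) s ∨ b.out i (r + 1) ∈ b.anchor (s + 1)))

end Backbone

/-! ### Votes and quorums in honest views -/

namespace Execution

variable {Tx : Type} {n : ℕ} {Φ Γ σ : Type} {Δ : ℕ} {e : Execution Tx n Φ Γ σ}

/-- Active validators send one vote per slot, at its voting round, and honest validators send
no other votes. -/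
structure VotesOnce (Δ : ℕ) (e : Execution Tx n Φ Γ σ) : Prop where
  vote : ∀ i t, e.env.Active Δ i (voting Δ t) →
    ∃ m : Vote Tx n Φ, m.slot = t ∧ m.sender = i ∧ e.sentVotes i (voting Δ t) = {m}
  vote_only : ∀ i r, e.env.Honest i r → (¬ ∃ t, r = voting Δ t ∧ e.env.Active Δ i r) →
    e.sentVotes i r = ∅

theorem VotesOnce.origin (h : VotesOnce Δ e) (hs : Synchronous Δ e) {j : Fin n} {r : ℕ}
    (hj : e.env.Honest j r) {m : Vote Tx n Φ} (hm : m ∈ e.votes j r)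
    (hk : e.env.Honest m.sender r) :
    voting Δ m.slot < r ∧ e.env.Active Δ m.sender (voting Δ m.slot) ∧
      e.sentVotes m.sender (voting Δ m.slot) = {m} := by
  obtain ⟨r', hr', hsent⟩ := hs.authentic_votes j r hj m hm hk
  by_cases hc : ∃ t, r' = voting Δ t ∧ e.env.Active Δ m.sender r'
  · obtain ⟨t, rfl, hact⟩ := hc
    obtain ⟨m', rfl, hsend, heq⟩ := h.vote _ t hact
    have : m = m' := by simpa [heq] using hsent
    subst this
    exact ⟨hr', hact, heq⟩
  · rw [h.vote_only _ r' (hk.of_le hr'.le) hc] at hsent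
    exact absurd hsent (Set.notMem_empty _)

theorem VotesOnce.eq_of_slot (h : VotesOnce Δ e) (hs : Synchronous Δ e) {j j' : Fin n} {r r' : ℕ}
    (hj : e.env.Honest j r) (hj' : e.env.Honest j' r') {m m' : Vote Tx n Φ}
    (hm : m ∈ e.votes j r) (hm' : m' ∈ e.votes j' r') (hk : e.env.Honest m.sender r)
    (hk' : e.env.Honest m'.sender r') (hsend : m'.sender = m.sender) (hslot : m'.slot = m.slot) :
    m' = m := by
  have h₁ := (h.origin hs hj hm hk).2.2
  have h₂ := (h.origin hs hj' hm' hk').2.2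
  rw [hsend, hslot, h₁] at h₂
  exact (Set.singleton_injective h₂).symm

/-- Two quorums of one slot, possibly in different honest views, share the vote of a validator
that is active in that slot. -/
theorem VotesOnce.quorum_inter (h : VotesOnce Δ e) (hs : Synchronous Δ e)
    (hc : e.env.Compliant Δ) {j j' : Fin n} {r r' : ℕ} {X Y : Chain Tx} {s : ℤ}
    (hj : e.env.Honest j r) (hj' : e.env.Honest j' r') (hX : IsQuorum (e.votes j r) X s)
    (hY : IsQuorum (e.votes j' r') Y s) :
    ∃ m, (m.slot : ℤ) = s ∧ e.env.Active Δ m.sender (voting Δ m.slot) ∧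
      m ∈ e.sentVotes m.sender (voting Δ m.slot) ∧ X.Pre m.chain ∧ Y.Pre m.chain := by
  obtain ⟨k, ⟨m, hm, rfl⟩, ⟨m', hm', hsend⟩, hk⟩ := hc.exists_honest hX hY
  have heq : m' = m := h.eq_of_slot hs hj hj' hm.1 hm'.1 (hk _) (hsend ▸ hk _) hsend
    (by have := hm.2.2; have := hm'.2.2; omega)
  subst heq
  have ho := h.origin hs hj hm.1 (hk _)
  exact ⟨m', hm.2.2, ho.2.1, ho.2.2 ▸ rfl, hm.2.1, hm'.2.1⟩

/-- The chain returned by `fastConfirmSimple` extends every chain with a quorum. -/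
theorem VotesOnce.quorum_pre_fastConfirmSimple (h : VotesOnce Δ e) (hs : Synchronous Δ e)
    (hc : e.env.Compliant Δ) {j : Fin n} {r : ℕ} {X : Chain Tx} {s : ℤ}
    (hj : e.env.Honest j r) (hX : IsQuorum (e.votes j r) X s) :
    X.Pre (fastConfirmSimple (e.votes j r) s).1 := by
  obtain ⟨hF, -, hp⟩ := fastConfirmSimple_of_quorum hc.pos (hs.votes_finite j r) hX
  obtain ⟨m, -, -, -, h₁, h₂⟩ := h.quorum_inter hs hc hj hj hX hF
  exact (Pre.compatible h₁ h₂).pre_of_p_le hp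

/-- No validator can have voted before the first slot. -/
theorem not_isQuorum_neg {V : Set (Vote Tx n Φ)} {X : Chain Tx} (hn : 0 < n) {s : ℤ}
    (h : s < 0) : ¬ IsQuorum V X s := fun hq => by
  obtain ⟨m, hm⟩ := hq.exists_mem hn
  have := hm.2.2
  omega

/-- Active proposers send one proposal, at the propose round of their slot, and honest validators
send no other proposals. -/
structure ProposesOnce (Δ : ℕ) (e : Execution Tx n Φ Γ σ) : Prop where
  propose : ∀ i t, e.env.Active Δ i (proposing Δ t) → e.env.proposer t = i →
    ∃ m : Proposal Tx n Φ Γ, m.slot = t ∧ m.sender = i ∧ e.sentProps i (proposing Δ t) = {m}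
  propose_only : ∀ i r, e.env.Honest i r →
    (¬ ∃ t, r = proposing Δ t ∧ e.env.Active Δ i r ∧ e.env.proposer t = i) →
    e.sentProps i r = ∅

theorem ProposesOnce.origin (h : ProposesOnce Δ e) (hs : Synchronous Δ e) {j : Fin n} {r : ℕ}
    (hj : e.env.Honest j r) {m : Proposal Tx n Φ Γ} (hm : m ∈ e.props j r)
    (hk : e.env.Honest m.sender r) :
    proposing Δ m.slot < r ∧ m ∈ e.sentProps m.sender (proposing Δ m.slot) := by
  obtain ⟨r', hr', hsent⟩ := hs.authentic_props j r hj m hm hk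
  by_cases hc : ∃ t, r' = proposing Δ t ∧ e.env.Active Δ m.sender r' ∧
      e.env.proposer t = m.sender
  · obtain ⟨t, rfl, hact, hprop⟩ := hc
    obtain ⟨m', hslot, -, heq⟩ := h.propose _ t hact hprop
    have : m = m' := by simpa [heq] using hsent
    subst this
    rw [hslot]
    exact ⟨hr', hsent⟩
  · rw [h.propose_only _ r' (hk.of_le hr'.le) hc] at hsent
    exact absurd hsent (Set.notMem_empty _)

/-- Since an active proposer stays honest until the voting round, a proposal that bears its name
is the one that it has sent. -/
theorem ProposesOnce.eq_of_sender (h : ProposesOnce Δ e) (hs : Synchronous Δ e)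
    (hc : e.env.Compliant Δ) {t : ℕ}
    (hp : e.env.Active Δ (e.env.proposer t) (proposing Δ t)) {m : Proposal Tx n Φ Γ}
    (hm : m ∈ e.sentProps (e.env.proposer t) (proposing Δ t)) {i : Fin n}
    (hi : e.env.Honest i (voting Δ t)) {m' : Proposal Tx n Φ Γ}
    (hm' : m' ∈ e.props i (voting Δ t)) (hslot : m'.slot = t)
    (hsend : m'.sender = e.env.proposer t) : m' = m := by
  have ho := (h.origin hs hi hm' (hsend ▸ hc.proposer_protected t hp)).2
  rw [hsend, hslot] at ho
  obtain ⟨m₀, -, -, heq⟩ := h.propose _ t hp rfl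
  rw [heq] at hm ho
  exact ho.trans hm.symm

theorem ProposesOnce.notMem_propsBefore (h : ProposesOnce Δ e) (hs : Synchronous Δ e) {t : ℕ}
    (hp : e.env.Active Δ (e.env.proposer t) (proposing Δ t)) {m : Proposal Tx n Φ Γ}
    (hm : m ∈ e.sentProps (e.env.proposer t) (proposing Δ t)) {i : Fin n}
    (hi : e.env.Honest i (proposing Δ t)) : m ∉ e.propsBefore i (proposing Δ t) := by
  obtain ⟨m₀, hslot, hsend, heq⟩ := h.propose _ t hp rfl
  rw [heq] at hm
  obtain rfl : m = m₀ := hm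
  intro hmem
  have hview : m ∈ e.props i (proposing Δ t) := by
    cases hr : proposing Δ t with
    | zero => rw [hr] at hmem; exact absurd hmem (Set.notMem_empty _)
    | succ r => rw [hr] at hmem; exact hs.props_mono i (Nat.le_succ r) hmem
  have := (h.origin hs hi hview (hsend ▸ hp.1)).1
  rw [hslot] at this
  exact lt_irrefl _ this

theorem _root_.List.foldl_mem_of_invariant {α β : Type} {f : β → α → β} {S : Set β} {l : List α}
    (hS : ∀ m ∈ l, ∀ a ∈ S, f a m ∈ S) {a : β} (ha : a ∈ S) : l.foldl f a ∈ S := by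
  induction l generalizing a with
  | nil => exact ha
  | cons m l ih =>
    exact ih (fun m' hm' => hS m' (List.mem_cons_of_mem m hm')) (hS m List.mem_cons_self a ha)

/-- What holds of the initial state and is preserved by every message holds of the result. -/
theorem HandlesAll.mem_of_invariant {α β : Type} {f : β → α → β} {X : Set α} {a b : β}
    (h : HandlesAll f X a b) {S : Set β} (hS : ∀ m ∈ X, ∀ a ∈ S, f a m ∈ S) (ha : a ∈ S) :
    b ∈ S := by
  obtain ⟨l, -, hl, rfl⟩ := h
  exact List.foldl_mem_of_invariant (fun m hm => hS m ((hl m).mp hm)) ha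

/-- What is brought about by one of the messages and preserved by all holds of the result. -/
theorem HandlesAll.mem_of_mem {α β : Type} {f : β → α → β} {X : Set α} {a b : β}
    (h : HandlesAll f X a b) {S S' : Set β} (hS : ∀ m ∈ X, ∀ a ∈ S, f a m ∈ S)
    (hS' : ∀ m ∈ X, ∀ a ∈ S', f a m ∈ S') (ha : a ∈ S) {m : α} (hm : m ∈ X)
    (hmS : ∀ a ∈ S, f a m ∈ S') : b ∈ S' := by
  obtain ⟨l, -, hl, rfl⟩ := h
  obtain ⟨l₁, l₂, rfl⟩ := List.append_of_mem ((hl m).mpr hm)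
  rw [List.foldl_append, List.foldl_cons]
  refine List.foldl_mem_of_invariant (fun m' hm' => hS' m' ((hl m').mp ?_))
    (hmS _ (List.foldl_mem_of_invariant (fun m' hm' => hS m' ((hl m').mp ?_)) ha))
  · exact List.mem_append_right _ (List.mem_cons_of_mem _ hm')
  · exact List.mem_append_left _ hm'

section Counting

variable {s r : ℕ} {j : Fin n} {B : Chain Tx}

/-- The vote of slot `s` of a validator that stays honest counts in every view of slot `s + 1`:
it has arrived, is the latest of its sender, and the sender does not equivocate. -/
theorem VotesOnce.mem_support (h : VotesOnce Δ e) (hs : Synchronous Δ e) {k : Fin n}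
    (hact : e.env.Active Δ k (voting Δ s)) (hk : e.env.Honest k (voting Δ (s + 1)))
    {m : Vote Tx n Φ} (hm : m ∈ e.sentVotes k (voting Δ s)) (hj : e.env.Running j r)
    (hr : merging Δ s ≤ r) (hr' : r ≤ voting Δ (s + 1)) (hB : B.Pre m.chain) :
    m.sender = k ∧ m ∈ support (e.votes j r) B (s + 1) := by
  have hview : m ∈ e.votes j r := hs.deliver_votes k (voting Δ s) j r hact.1 hj
    (by simp only [merging_eq, voting_eq] at *; omega) hm
  obtain ⟨m', hslot, hsend, heq⟩ := h.vote k s hact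
  rw [heq] at hm
  obtain rfl : m = m' := hm
  subst hsend
  have hkr := hk.of_le hr'
  refine ⟨rfl, ⟨⟨⟨⟨hview, ?_⟩, by omega⟩, ?_⟩, hB⟩⟩
  · rintro ⟨a, ha, a', ha', hsa, hsa', hslots, hne⟩
    exact hne (congrArg Vote.chain (h.eq_of_slot hs hj.1 hj.1 ha' ha (hsa'.symm ▸ hkr)
      (hsa.symm ▸ hkr) (hsa.trans hsa'.symm) hslots))
  · intro a ha hsa
    have ho := h.origin hs hj.1 ha.1.1 (hsa.symm ▸ hkr)
    have := lt_of_voting_lt_voting (lt_of_lt_of_le ho.1 hr')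
    omega

/-- If all active validators vote in slot `s` for extensions of `B`, then those among them that
stay honest form a majority for `B` in slot `s + 1`, by the sleepiness condition. -/
theorem VotesOnce.hasMajority (h : VotesOnce Δ e) (hs : Synchronous Δ e)
    (hc : e.env.Compliant Δ)
    (hB : ∀ i, e.env.Active Δ i (voting Δ s) → ∀ m ∈ e.sentVotes i (voting Δ s), B.Pre m.chain)
    {r₀ : ℕ} (hj₀ : e.env.Running j r₀) (hj : e.env.Running j r) (hr₀ : merging Δ s ≤ r₀)
    (hr : r₀ ≤ r) (hr' : r ≤ voting Δ (s + 1)) :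
    HasMajority (e.votes j r₀) (e.votes j r) B (s + 1) := by
  set A := e.env.corrupted (voting Δ (s + 1))
  set H := e.env.active Δ (voting Δ s) \ A
  have hlow : H ⊆ voters (support (e.votes j r₀) B (s + 1) ∩ support (e.votes j r) B (s + 1)) := by
    rintro k ⟨hk, hkA⟩
    obtain ⟨m, -, -, heq⟩ := h.vote k s hk
    have hm : m ∈ e.sentVotes k (voting Δ s) := heq ▸ rfl
    have h₁ := h.mem_support hs hk hkA hm hj₀ hr₀ (hr.trans hr') (hB k hk m hm)
    have h₂ := h.mem_support hs hk hkA hm hj (hr₀.trans hr) hr' (hB k hk m hm)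
    exact ⟨m, ⟨h₁.2, h₂.2⟩, h₁.1⟩
  have hup : voters (filExp (e.votes j r) (s + 1)) ⊆ A ∪ H := by
    rintro k ⟨m, hm, rfl⟩
    by_cases hkA : m.sender ∈ A
    · exact Or.inl hkA
    · have hkr : e.env.Honest m.sender r := Env.Honest.of_le hkA hr'
      have ho := h.origin hs hj.1 hm.1 hkr
      have hlt := lt_of_voting_lt_voting (lt_of_lt_of_le ho.1 hr')
      have hslot : m.slot = s := by
        have : s + 1 ≤ m.slot + 1 := hm.2
        omega
      exact Or.inr ⟨hslot ▸ ho.2.1, hkA⟩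
  have h₁ := Set.ncard_le_ncard hlow (Set.toFinite _)
  have h₂ := Set.ncard_le_ncard hup (Set.toFinite _)
  have h₃ := Set.ncard_union_le A H
  have h₄ : A.ncard < H.ncard := hc.sleepiness s
  unfold HasMajority
  omega

/-- A majority in slot `s + 1` contains the vote of slot `s` of an honest validator. -/
theorem VotesOnce.exists_honest_of_hasMajority (h : VotesOnce Δ e) (hs : Synchronous Δ e)
    (hc : e.env.Compliant Δ) {V : Set (Vote Tx n Φ)} (hj : e.env.Running j r)
    (hr : merging Δ s ≤ r) (hr' : r ≤ voting Δ (s + 1))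
    (hB : HasMajority V (e.votes j r) B (s + 1)) :
    ∃ m, e.env.Active Δ m.sender (voting Δ s) ∧ m ∈ e.sentVotes m.sender (voting Δ s) ∧
      B.Pre m.chain := by
  set A := e.env.corrupted (voting Δ (s + 1))
  set H := e.env.active Δ (voting Δ s) \ A
  set S := voters (support V B (s + 1) ∩ support (e.votes j r) B (s + 1))
  by_cases hSA : S ⊆ A
  · exfalso
    have hH : H ⊆ voters (filExp (e.votes j r) (s + 1)) := by
      rintro k ⟨hk, hkA⟩
      obtain ⟨m, -, -, heq⟩ := h.vote k s hk
      have hm : m ∈ e.sentVotes k (voting Δ s) := heq ▸ rfl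
      have h₁ := h.mem_support hs hk hkA hm hj hr hr' (Chain.genesis_pre _)
      exact ⟨m, support_subset _ _ _ h₁.2, h₁.1⟩
    have hS : S ⊆ voters (filExp (e.votes j r) (s + 1)) :=
      voters_mono fun m hm => support_subset _ _ _ hm.2
    have hdisj : Disjoint S H := Set.disjoint_left.mpr fun k hk hk' => hk'.2 (hSA hk)
    have h₁ := Set.ncard_le_ncard (Set.union_subset hS hH) (Set.toFinite _)
    have h₂ := Set.ncard_union_eq hdisj (Set.toFinite _) (Set.toFinite _)
    have h₃ := Set.ncard_le_ncard hSA (Set.toFinite _)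
    have h₄ : A.ncard < H.ncard := hc.sleepiness s
    have h₅ : (voters (filExp (e.votes j r) (s + 1))).ncard < 2 * S.ncard := hB
    omega
  · obtain ⟨k, ⟨m, hm, rfl⟩, hkA⟩ := Set.not_subset.mp hSA
    have hkr : e.env.Honest m.sender r := Env.Honest.of_le hkA hr'
    have hexp := support_subset _ _ _ hm.2
    have ho := h.origin hs hj.1 hexp.1 hkr
    have hlt := lt_of_voting_lt_voting (lt_of_lt_of_le ho.1 hr')
    have hslot : m.slot = s := by
      have : s + 1 ≤ m.slot + 1 := hexp.2
      omega
    rw [hslot] at ho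
    exact ⟨m, ho.2.1, ho.2.2 ▸ rfl, hm.2.2⟩

end Counting

end Execution

/-! ### Persistence of unanimous votes, pivot slots, and outputs -/

namespace Backbone

variable {Tx : Type} {n : ℕ} {Φ Γ σ : Type} {Δ κ T : ℕ} {b : Backbone Tx n Φ Γ σ}

namespace Lawful

theorem votesOnce (L : b.Lawful Δ κ) : Execution.VotesOnce Δ b.e where
  vote i t h := by
    obtain ⟨D, φ, -, heq⟩ := L.vote i t h
    exact ⟨_, rfl, rfl, heq⟩
  vote_only := L.vote_only

theorem proposesOnce (L : b.Lawful Δ κ) : Execution.ProposesOnce Δ b.e where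
  propose i t h h' := by
    obtain ⟨m, -, hslot, hsend, heq⟩ := L.propose i t h h'
    exact ⟨m, hslot, hsend, heq⟩
  propose_only := L.propose_only

theorem exists_vote (L : b.Lawful Δ κ) (s : ℕ) :
    ∃ i m, b.e.env.Active Δ i (voting Δ s) ∧ m ∈ b.e.sentVotes i (voting Δ s) := by
  obtain ⟨i, hi⟩ := L.compliant.exists_active s
  obtain ⟨m, -, -, heq⟩ := L.votesOnce.vote i s hi
  exact ⟨i, m, hi, heq ▸ rfl⟩

/-- Either way, a candidate of slot `s + 1` is a prefix of some vote of slot `s` of an active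
validator: quorums contain honest votes. -/
theorem candidate_succ {s : ℕ} (hA : b.Anchored Δ (s + 1)) {X : Chain Tx}
    (hX : b.Candidate Δ (s + 1) X) :
    b.VotesExtend Δ s X ∨ ∃ j r, b.e.env.Honest j r ∧ r ≤ voting Δ (s + 1) ∧
      IsQuorum (b.e.votes j r) X s := by
  rcases hX with hX | ⟨j, r, hj, hr, hq⟩
  · left
    rcases hA X hX with rfl | ⟨s', hs', h⟩
    · exact fun _ _ _ _ => Chain.genesis_pre _
    · obtain rfl : s = s' := by omega
      exact h
  · right
    exact ⟨j, r, hj, hr, by simpa using hq⟩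

theorem candidate_zero (L : b.Lawful Δ κ) (hA : b.Anchored Δ 0) {X : Chain Tx}
    (hX : b.Candidate Δ 0 X) : X = Chain.genesis := by
  rcases hX with hX | ⟨j, r, hj, hr, hq⟩
  · rcases hA X hX with h | ⟨s, hs, -⟩
    · exact h
    · omega
  · exact absurd hq (Execution.not_isQuorum_neg L.compliant.pos (by simp))

theorem votesExtend_compatible (L : b.Lawful Δ κ) {s : ℕ} (hA : b.Anchored Δ (s + 1))
    {X B : Chain Tx} (hX : b.Candidate Δ (s + 1) X) (hB : b.VotesExtend Δ s B) :
    Compatible X B := by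
  rcases candidate_succ hA hX with h | ⟨j, r, hj, -, hq⟩
  · obtain ⟨i, m, hi, hm⟩ := L.exists_vote s
    exact Pre.compatible (h i hi m hm) (hB i hi m hm)
  · obtain ⟨m, hslot, hact, hm, h₁, -⟩ :=
      L.votesOnce.quorum_inter L.synchronous L.compliant hj hj hq hq
    obtain rfl : m.slot = s := by exact_mod_cast hslot
    exact Pre.compatible h₁ (hB _ hact m hm)

theorem candidatesCompatible (L : b.Lawful Δ κ) {t : ℕ} (hA : b.Anchored Δ t) :
    b.CandidatesCompatible Δ t := by
  intro X Y hX hY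
  cases t with
  | zero =>
    rw [L.candidate_zero hA hX]
    exact Or.inl (Chain.genesis_pre _)
  | succ s =>
    rcases candidate_succ hA hX with h | ⟨j, r, hj, -, hq⟩
    · exact (L.votesExtend_compatible hA hY h).symm
    · rcases candidate_succ hA hY with h | ⟨j', r', hj', -, hq'⟩
      · exact L.votesExtend_compatible hA hX h
      · obtain ⟨m, -, -, -, h₁, h₂⟩ :=
          L.votesOnce.quorum_inter L.synchronous L.compliant hj hj' hq hq'
        exact Pre.compatible h₁ h₂

theorem pre_forkP (L : b.Lawful Δ κ) {s : ℕ} (hA : b.Anchored Δ (s + 1)) {B : Chain Tx}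
    (hB : b.VotesExtend Δ s B) {j : Fin n} (hj : b.e.env.Active Δ j (proposing Δ (s + 1))) :
    B.Pre (b.forkP Δ j (s + 1)) := by
  have hmaj := L.votesOnce.hasMajority L.synchronous L.compliant hB hj.running hj.running
    (merging_le_proposing s) le_rfl (Nat.le_add_right _ _)
  exact hmaj.pre_mfc (L.synchronous.votes_finite _ _)
    (L.votesExtend_compatible hA (L.baseP_candidate j _ hj) hB)

theorem pre_forkV (L : b.Lawful Δ κ) {s : ℕ} (hA : b.Anchored Δ (s + 1)) {B : Chain Tx}
    (hB : b.VotesExtend Δ s B) {j : Fin n} (hj : b.e.env.Active Δ j (voting Δ (s + 1))) :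
    B.Pre (b.forkV Δ j (s + 1)) := by
  have hle : merging Δ s ≤ voting Δ (s + 1) :=
    (merging_le_proposing s).trans (Nat.le_add_right _ _)
  have hmaj := L.votesOnce.hasMajority L.synchronous L.compliant hB
    (hj.running_of_merging_le le_rfl hle) hj.running le_rfl hle le_rfl
  rw [← L.frozen_succ j s hj] at hmaj
  exact hmaj.pre_mfc (L.synchronous.votes_finite _ _)
    (L.votesExtend_compatible hA (L.baseV_candidate j _ hj) hB)

theorem baseP_pre_forkP (L : b.Lawful Δ κ) (j : Fin n) (t : ℕ) :
    (b.baseP j t).Pre (b.forkP Δ j t) :=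
  (mfc_spec (L.synchronous.votes_finite _ _)).1

theorem baseV_pre_forkV (L : b.Lawful Δ κ) (j : Fin n) (t : ℕ) :
    (b.baseV j t).Pre (b.forkV Δ j t) :=
  (mfc_spec (L.synchronous.votes_finite _ _)).1

theorem forkV_pre_vote (L : b.Lawful Δ κ) {t : ℕ} {j : Fin n}
    (hj : b.e.env.Active Δ j (voting Δ t)) {m : Vote Tx n Φ}
    (hm : m ∈ b.e.sentVotes j (voting Δ t)) : (b.forkV Δ j t).Pre m.chain := by
  obtain ⟨D, φ, hD, heq⟩ := L.vote j t hj
  rw [heq] at hm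
  obtain rfl : m = _ := hm
  rcases hD with hD | ⟨-, rfl⟩
  · exact hD.1
  · exact Pre.refl _

theorem votesExtend_of_pre_forkV (L : b.Lawful Δ κ) {t : ℕ} {B : Chain Tx}
    (h : ∀ j, b.e.env.Active Δ j (voting Δ t) → B.Pre (b.forkV Δ j t)) : b.VotesExtend Δ t B :=
  fun j hj _ hm => (h j hj).trans (L.forkV_pre_vote hj hm)

theorem votesExtend_of_le (L : b.Lawful Δ κ) {s t : ℕ} (hst : s ≤ t)
    (hA : ∀ t' ≤ t, b.Anchored Δ t') {B : Chain Tx} (hB : b.VotesExtend Δ s B) :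
    b.VotesExtend Δ t B := by
  induction t, hst using Nat.le_induction with
  | base => exact hB
  | succ t hst ih =>
    have := ih fun t' ht' => hA t' (by omega)
    exact L.votesExtend_of_pre_forkV fun j hj => L.pre_forkV (hA _ le_rfl) this hj

/-- A chain extended by all active votes of a slot is a prefix of all later fork choices. -/
theorem pre_forks_of_lt (L : b.Lawful Δ κ) {s t : ℕ} (hst : s < t)
    (hA : ∀ t' ≤ t, b.Anchored Δ t') {B : Chain Tx} (hB : b.VotesExtend Δ s B) (j : Fin n) :
    (b.e.env.Active Δ j (proposing Δ t) → B.Pre (b.forkP Δ j t)) ∧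
      (b.e.env.Active Δ j (voting Δ t) → B.Pre (b.forkV Δ j t)) := by
  obtain ⟨t, rfl⟩ : ∃ u, t = u + 1 := ⟨t - 1, by omega⟩
  have := L.votesExtend_of_le (Nat.le_of_lt_succ hst) (fun t' ht' => hA t' (by omega)) hB
  exact ⟨L.pre_forkP (hA _ le_rfl) this, L.pre_forkV (hA _ le_rfl) this⟩

/-- Fork choices of slot `t` are shorter than `t`, so that `Extend` is defined on them. -/
theorem fork_p_lt (L : b.Lawful Δ κ) (t : ℕ) (hA : ∀ t' ≤ t, b.Anchored Δ t') (j : Fin n) :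
    (b.e.env.Active Δ j (proposing Δ t) → (b.forkP Δ j t).p < t) ∧
      (b.e.env.Active Δ j (voting Δ t) → (b.forkV Δ j t).p < t) := by
  induction t generalizing j with
  | zero =>
    constructor
    · intro hj
      have hV : b.e.votes j (proposing Δ 0) = ∅ := L.synchronous.votes_zero j
      rcases (mfc_spec (V := b.e.votes j (proposing Δ 0)) (C := b.baseP j 0) (t := 0)
        (L.synchronous.votes_finite j (proposing Δ 0))).2.1 with h | h
      · have hg := L.candidate_zero (hA 0 le_rfl) (L.baseP_candidate j 0 hj)
        unfold forkP
        rw [h, hg, Chain.p_genesis]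
        simp
      · obtain ⟨m, hm, -⟩ := h.exists_mem
        have : m ∈ b.e.votes j (proposing Δ 0) := (support_subset _ _ _ hm).1
        rw [hV] at this
        exact absurd this (Set.notMem_empty _)
    · intro hj
      rcases (mfc_spec (V := b.frozenVotes j 0) (C := b.baseV j 0) (t := 0)
        (L.synchronous.votes_finite j (voting Δ 0))).2.1 with h | h
      · have hg := L.candidate_zero (hA 0 le_rfl) (L.baseV_candidate j 0 hj)
        unfold forkV
        rw [h, hg, Chain.p_genesis]
        simp
      · obtain ⟨m, hm, -⟩ := h.exists_mem
        have : m ∈ b.frozenVotes j 0 := (support_subset _ _ _ hm).1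
        rw [L.frozen_zero j hj] at this
        exact absurd this (Set.notMem_empty _)
  | succ s ih =>
    have hvote : ∀ i m, b.e.env.Active Δ i (voting Δ s) → m ∈ b.e.sentVotes i (voting Δ s) →
        m.chain.p < ((s + 1 : ℕ) : ℤ) := by
      intro i m hi hm
      obtain ⟨D, φ, hD, heq⟩ := L.vote i s hi
      rw [heq] at hm
      obtain rfl : m = _ := hm
      rcases hD with hD | ⟨-, rfl⟩
      · have : D.p = s := hD.2.1
        push_cast
        simp [this]
      · have := (ih (fun t' ht' => hA t' (by omega)) i).2 hi
        push_cast
        omega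
    have hcand : ∀ X, b.Candidate Δ (s + 1) X → X.p < ((s + 1 : ℕ) : ℤ) := by
      intro X hX
      rcases candidate_succ (hA _ le_rfl) hX with h | ⟨j, r, hj, -, hq⟩
      · obtain ⟨i, m, hi, hm⟩ := L.exists_vote s
        exact lt_of_le_of_lt (h i hi m hm).p_le (hvote i m hi hm)
      · obtain ⟨m, hslot, hact, hm, h₁, -⟩ :=
          L.votesOnce.quorum_inter L.synchronous L.compliant hj hj hq hq
        obtain rfl : m.slot = s := by exact_mod_cast hslot
        exact lt_of_le_of_lt h₁.p_le (hvote _ m hact hm)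
    have hmaj : ∀ V r X, b.e.env.Running j r → merging Δ s ≤ r → r ≤ voting Δ (s + 1) →
        HasMajority V (b.e.votes j r) X (s + 1) → X.p < ((s + 1 : ℕ) : ℤ) := by
      intro V r X hj hr hr' hX
      obtain ⟨m, hact, hm, h₁⟩ := L.votesOnce.exists_honest_of_hasMajority L.synchronous
        L.compliant hj hr hr' hX
      exact lt_of_le_of_lt h₁.p_le (hvote _ m hact hm)
    constructor
    · intro hj
      rcases (mfc_spec (V := b.e.votes j (proposing Δ (s + 1))) (C := b.baseP j (s + 1))
        (t := s + 1) (L.synchronous.votes_finite j (proposing Δ (s + 1)))).2.1 with h | h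
      · unfold forkP
        rw [h]
        exact hcand _ (L.baseP_candidate j _ hj)
      · exact hmaj _ _ _ hj.running (merging_le_proposing s) (Nat.le_add_right _ _) h
    · intro hj
      rcases (mfc_spec (V := b.frozenVotes j (s + 1)) (C := b.baseV j (s + 1))
        (t := s + 1) (L.synchronous.votes_finite j (voting Δ (s + 1)))).2.1 with h | h
      · unfold forkV
        rw [h]
        exact hcand _ (L.baseV_candidate j _ hj)
      · exact hmaj _ _ _ hj.running ((merging_le_proposing s).trans (Nat.le_add_right _ _))
          le_rfl h

/-- The fork choice of every voter is a prefix of the fork choice of an active proposer of the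
same slot. A majority for the former lies between the votes frozen before the proposal and those
received by the voting round, hence is a majority for the proposer as well. -/
theorem forkV_pre_forkP (L : b.Lawful Δ κ) {t : ℕ} (hA : ∀ t' ≤ t, b.Anchored Δ t')
    (hp : b.e.env.Active Δ (b.e.env.proposer t) (proposing Δ t)) {i : Fin n}
    (hi : b.e.env.Active Δ i (voting Δ t))
    (h₁ : (b.baseP (b.e.env.proposer t) t).Pre (b.baseV i t))
    (h₂ : (b.baseV i t).Pre (b.baseP (b.e.env.proposer t) t) ∨ b.baseV i t ∈ b.anchor t) :
    (b.forkV Δ i t).Pre (b.forkP Δ (b.e.env.proposer t) t) := by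
  rcases (mfc_spec (V := b.frozenVotes i t) (C := b.baseV i t) (t := t)
    (L.synchronous.votes_finite i (voting Δ t))).2.1 with h | h
  · change b.forkV Δ i t = _ at h
    rw [h]
    rcases h₂ with h₂ | h₂
    · exact h₂.trans (L.baseP_pre_forkP _ _)
    · rcases hA t le_rfl _ h₂ with hg | ⟨s, rfl, hs⟩
      · rw [hg]
        exact Chain.genesis_pre _
      · exact L.pre_forkP (hA _ le_rfl) hs hp
  · change HasMajority _ _ (b.forkV Δ i t) t at h
    cases t with
    | zero =>
      obtain ⟨m, hm, -⟩ := h.exists_mem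
      have : m ∈ b.frozenVotes i 0 := (support_subset _ _ _ hm).1
      rw [L.frozen_zero i hi] at this
      exact absurd this (Set.notMem_empty _)
    | succ s =>
      rw [L.frozen_succ i s hi] at h
      have hm : b.e.env.Running i (merging Δ s) := hi.running_of_merging_le le_rfl
        ((merging_le_proposing s).trans (Nat.le_add_right _ _))
      have hmaj := h.of_between
        (L.synchronous.gossip_votes i _ _ (proposing Δ (s + 1)) hm hp.running
          (by rw [merging_eq, proposing_succ]; omega))
        (L.synchronous.gossip_votes _ _ i _ hp.running hi.running (by rw [voting_eq]))
      exact hmaj.pre_mfc (L.synchronous.votes_finite _ _)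
        (Or.inl (h₁.trans (L.baseV_pre_forkV _ _)))

/-- An active proposer is a pivot: all active validators vote for its proposal. -/
theorem votesExtend_proposal (L : b.Lawful Δ κ) {t : ℕ} (hA : ∀ t' ≤ t, b.Anchored Δ t')
    (hp : b.e.env.Active Δ (b.e.env.proposer t) (proposing Δ t)) :
    ∃ m, b.e.sentProps (b.e.env.proposer t) (proposing Δ t) = {m} ∧ m.chain.p = t ∧
      (b.forkP Δ (b.e.env.proposer t) t).Pre m.chain ∧ b.VotesExtend Δ t m.chain := by
  obtain ⟨m, hext, hslot, hsend, heq⟩ := L.propose _ t hp rfl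
  obtain ⟨hpre, hmp, -⟩ := hext ((L.fork_p_lt t hA _).1 hp)
  refine ⟨m, heq, hmp, hpre, fun i hi v hv => ?_⟩
  have hm : m ∈ b.e.props i (voting Δ t) := L.synchronous.deliver_props _ _ i _ hp.1 hi.running
    (by rw [voting_eq]) (heq ▸ rfl)
  obtain ⟨h₁, h₂⟩ := L.adopt t (L.candidatesCompatible (hA t le_rfl)) hp m (heq ▸ rfl) hmp i hi hm
  have hfork := (L.forkV_pre_forkP hA hp hi h₁ h₂).trans hpre
  obtain ⟨D, φ, hD, hveq⟩ := L.vote i t hi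
  rw [hveq] at hv
  obtain rfl : v = _ := hv
  rcases hD with ⟨-, -, m', hm', hslot', hsend', rfl⟩ | ⟨hempty, -⟩
  · obtain rfl : m' = m := L.proposesOnce.eq_of_sender L.synchronous L.compliant hp (heq ▸ rfl)
      hi.1 hm' hslot' hsend'
    exact Pre.refl _
  · exact absurd hempty (Set.Nonempty.ne_empty ⟨m.chain, hfork, hmp, m, hm, hslot, hsend, rfl⟩)

end Lawful

/-- Each window of `κ` slots that ends before the last of the first `T` slots has a slot with an
active proposer. -/
def _root_.Sleepy.Env.Pivotal (Δ κ T : ℕ) (E : Env n) : Prop :=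
  ∀ s, s + κ < T → ∃ t, s ≤ t ∧ t < s + κ ∧ E.Active Δ (E.proposer t) (proposing Δ t)

namespace Lawful

/-- Outputs are prefixes of later fork choices. A `κ`-deep prefix is covered by the proposal of a
pivot slot, a fast-confirmed chain by the starting chains of the next slot, and an anchor by
all votes of the preceding slot. -/
theorem out_pre_forks (L : b.Lawful Δ κ) (hpiv : b.e.env.Pivotal Δ κ T) {t : ℕ}
    (hA : ∀ t' ≤ t, b.Anchored Δ t') (r : ℕ) (hrT : r < proposing Δ T) (i : Fin n)
    (hi : b.e.env.Honest i r) (j : Fin n) :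
    (r ≤ proposing Δ t → b.e.env.Active Δ j (proposing Δ t) →
      (b.out i r).Pre (b.forkP Δ j t)) ∧
    (r ≤ voting Δ t → b.e.env.Active Δ j (voting Δ t) →
      (b.out i r).Pre (b.forkV Δ j t)) := by
  have hΔ := L.pos
  have hsettled : ∀ X : Chain Tx, (X = Chain.genesis ∨ ∃ s < t, b.VotesExtend Δ s X) →
      (b.e.env.Active Δ j (proposing Δ t) → X.Pre (b.forkP Δ j t)) ∧
      (b.e.env.Active Δ j (voting Δ t) → X.Pre (b.forkV Δ j t)) := by
    rintro X (rfl | ⟨s, hs, hX⟩)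
    · exact ⟨fun _ => Chain.genesis_pre _, fun _ => Chain.genesis_pre _⟩
    · exact L.pre_forks_of_lt hs hA hX j
  suffices h : r ≤ voting Δ t →
      (r ≤ proposing Δ t → b.e.env.Active Δ j (proposing Δ t) →
        (b.out i r).Pre (b.forkP Δ j t)) ∧
      (b.e.env.Active Δ j (voting Δ t) → (b.out i r).Pre (b.forkV Δ j t)) from
    ⟨fun hr => (h (hr.trans (Nat.le_add_right _ _))).1 hr, fun hr => (h hr).2⟩
  intro hr
  induction r with
  | zero =>
    have := hsettled (b.out i 0) (Or.inl (L.out_zero i hi))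
    exact ⟨fun _ => this.1, this.2⟩
  | succ r ih =>
    rcases L.out_succ i r hi with h | ⟨s, hs, hact, h⟩ | ⟨s, hs, hrun, h⟩
    · rw [h]
      have := ih (by omega) (hi.of_le (Nat.le_succ r)) (by omega)
      exact ⟨fun hr => this.1 (by omega), this.2⟩
    · have hst : s ≤ t := by
        by_contra hlt
        have := proposing_add_le (Δ := Δ) (not_le.mp hlt)
        simp only [voting_eq] at *
        omega
      have hsT : s < T := by
        by_contra hlt
        have := proposing_le_proposing (Δ := Δ) (not_lt.mp hlt)
        simp only [voting_eq] at *
        omega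
      have key := hsettled (b.out i (r + 1)) (by
        rcases h with h | h
        · rw [h]
          obtain ⟨hpre, hdeep⟩ := Chain.deepPrefix_spec (b.forkV Δ i s) κ s
          rcases hdeep with hg | hdeep
          · exact Or.inl hg
          · by_cases hκ : s < κ
            · exact Or.inl (Chain.eq_genesis_of_p_neg (by omega))
            · right
              obtain ⟨u, hu, hu', hp⟩ := hpiv (s - κ) (by omega)
              obtain ⟨m, -, hmp, -, hm⟩ :=
                L.votesExtend_proposal (fun t' ht' => hA t' (by omega)) hp
              rw [hs] at hact
              have hfork := (L.pre_forks_of_lt (show u < s by omega)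
                (fun t' ht' => hA t' (by omega)) hm i).2 hact
              have hle := (Pre.compatible hpre hfork).pre_of_p_le (by omega)
              exact ⟨u, by omega, fun k hk v hv => hle.trans (hm k hk v hv)⟩
        · rcases hA s hst _ h with hg | ⟨s', rfl, hs'⟩
          · exact Or.inl hg
          · exact Or.inr ⟨s', by omega, hs'⟩)
      exact ⟨fun _ => key.1, key.2⟩
    · have hst : s < t := by
        by_contra hlt
        have := proposing_le_proposing (Δ := Δ) (not_lt.mp hlt)
        simp only [voting_eq, fastConfirming_eq] at *
        omega
      have hcc := L.candidatesCompatible (hA (s + 1) hst)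
      rcases h with h | h
      · rw [hs] at h hrun
        have hV := L.lockV s hcc i hrun _ h
        have hP := L.lockP s hcc i hrun _ h
        rw [← hs] at hV hP
        rcases Nat.lt_or_ge (s + 1) t with hlt | hge
        · have key := hsettled (b.out i (r + 1)) (Or.inr ⟨s + 1, hlt,
            L.votesExtend_of_pre_forkV fun k hk => (hV k hk).trans (L.baseV_pre_forkV _ _)⟩)
          exact ⟨fun _ => key.1, key.2⟩
        · obtain rfl : t = s + 1 := by omega
          exact ⟨fun _ hj => (hP j hj).trans (L.baseP_pre_forkP _ _),
            fun hj => (hV j hj).trans (L.baseV_pre_forkV _ _)⟩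
      · have key := hsettled (b.out i (r + 1)) (by
          rcases hA (s + 1) hst _ h with hg | ⟨s', hs', hv⟩
          · exact Or.inl hg
          · obtain rfl : s = s' := by omega
            exact Or.inr ⟨s, hst, hv⟩)
        exact ⟨fun _ => key.1, key.2⟩

/-- Anchors stem from outputs of earlier slots, and these are extended by all votes of their slot
provided that the anchors of earlier slots are harmless. -/
theorem anchored (L : b.Lawful Δ κ) (hpiv : b.e.env.Pivotal Δ κ T) (t : ℕ) (ht : t ≤ T) :
    b.Anchored Δ t := by
  induction t using Nat.strong_induction_on with
  | _ t ih =>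
    intro G hG
    rcases L.anchor_origin t G hG with hg | ⟨s, hst, k, hk, h⟩
    · exact Or.inl hg
    · obtain ⟨t, rfl⟩ : ∃ u, t = u + 1 := ⟨t - 1, by omega⟩
      have hA : ∀ t' ≤ t, b.Anchored Δ t' := fun t' ht' => ih t' (by omega) (by omega)
      rcases h with rfl | h
      · right
        have hrT : voting Δ s < proposing Δ T := by
          have := proposing_add_le (Δ := Δ) (show s < T by omega)
          have := L.pos
          rw [voting_eq]
          omega
        have hs : b.VotesExtend Δ s (b.out k (voting Δ s)) := L.votesExtend_of_pre_forkV
          fun j hj => (L.out_pre_forks hpiv (fun t' ht' => hA t' (by omega)) _ hrT k hk.1 j).2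
            le_rfl hj
        exact ⟨t, rfl, L.votesExtend_of_le (by omega) hA hs⟩
      · rcases hA s (by omega) G h with hg | ⟨s', rfl, hs'⟩
        · exact Or.inl hg
        · exact Or.inr ⟨t, rfl, L.votesExtend_of_le (by omega) hA hs'⟩

theorem outputsCanonical (L : b.Lawful Δ κ) (hpiv : b.e.env.Pivotal Δ κ T) :
    OutputsCanonical Δ T b.e b.out (b.forkP Δ) (b.forkV Δ) := by
  intro r i hi t ht j
  have hA : ∀ t' ≤ t, b.Anchored Δ t' := fun t' ht' => L.anchored hpiv t' (by omega)
  have hlt := proposing_add_le (Δ := Δ) ht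
  have hΔ := L.pos
  have key : r ≤ voting Δ t → _ := fun hr =>
    L.out_pre_forks hpiv hA r (by rw [voting_eq] at hr; omega) i hi j
  exact ⟨fun hr => (key (hr.trans (Nat.le_add_right _ _))).1 hr, fun hr => (key hr).2 hr⟩

theorem reorgResilient (L : b.Lawful Δ κ) (hpiv : b.e.env.Pivotal Δ κ T) :
    ReorgResilient Δ T b.e b.out := by
  intro t ht k hk m hm r hr i hi
  have hΔ := L.pos
  have hA : ∀ t' ≤ T, b.Anchored Δ t' := L.anchored hpiv
  have hprop : b.e.env.Active Δ k (proposing Δ t) ∧ b.e.env.proposer t = k := by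
    by_contra hc
    rw [L.propose_only k _ hk] at hm
    · exact absurd hm (Set.notMem_empty _)
    · rintro ⟨t', ht', h₁, h₂⟩
      rw [← proposing_injective hΔ ht'] at h₂
      exact hc ⟨h₁, h₂⟩
  obtain ⟨hact, rfl⟩ := hprop
  obtain ⟨m', heq, -, hfork, hvotes⟩ :=
    L.votesExtend_proposal (fun t' ht' => hA t' (by omega)) hact
  rw [heq] at hm
  obtain rfl : m = m' := hm
  have hcompat : Compatible m.chain (b.out i r) := by
    by_cases hrt : r ≤ proposing Δ t
    · exact Or.inr (((L.out_pre_forks hpiv (fun t' ht' => hA t' (by omega)) r hr i hi _).1 hrt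
        hact).trans hfork)
    · -- Compare both chains with a fork choice in the slot after round `r`.
      obtain ⟨u, q, hq, hu, -⟩ := exists_round_eq hΔ r
      have huT : u < T := by
        by_contra hlt
        have := proposing_le_proposing (Δ := Δ) (not_lt.mp hlt)
        change r < proposing Δ T at hr
        omega
      have htu : t < u + 1 := by
        by_contra hlt
        have := proposing_le_proposing (Δ := Δ) (not_lt.mp hlt)
        rw [proposing_succ] at this
        omega
      have hA' : ∀ t' ≤ u + 1, b.Anchored Δ t' := fun t' ht' => hA t' (by omega)
      obtain ⟨j, hj⟩ := L.compliant.exists_active (u + 1)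
      exact Pre.compatible ((L.pre_forks_of_lt htu hA' hvotes j).2 hj)
        ((L.out_pre_forks hpiv hA' r hr i hi j).2 (by rw [voting_eq, proposing_succ]; omega) hj)
  exact fun hc => hcompat.elim hc.1 hc.2

end Lawful

end Backbone

/-! ### The protocol without finality -/

theorem cast_succ_sub_one (s : ℕ) : ((s + 1 : ℕ) : ℤ) - 1 = s := by
  push_cast
  ring

/-- The certificate of a fast-confirmed chain is valid on its own. -/
theorem fastConfirmSimple_certified {Tx Φ : Type} {n : ℕ} {V : Set (Vote Tx n Φ)} {s : ℤ}
    (hn : 0 < n) (hV : V.Finite) :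
    (fastConfirmSimple V s).1 = Chain.genesis ∨
      IsQuorum (fastConfirmSimple V s).2 (fastConfirmSimple V s).1 s := by
  rcases fastConfirmSimple_cases (s := s) hn hV with ⟨hq, h⟩ | h
  · rw [h]
    exact Or.inr (isQuorum_slotVotes hq)
  · rw [h]
    exact Or.inl rfl

namespace TobExecution

variable {Tx : Type} {n Δ κ : ℕ} {e : TobExecution Tx n}

/-- The only anchor is genesis. -/
noncomputable def backbone (Δ : ℕ) (e : TobExecution Tx n) :
    Backbone Tx n Unit Unit (TobState Tx n) where
  e := e
  out i r := (e.state i r).conf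
  frozenVotes i t := (e.state i (voting Δ t)).frozenVotes
  baseP i t := (fastConfirmSimple (e.votes i (proposing Δ t)) ((t : ℤ) - 1)).1
  baseV i t := (e.state i (voting Δ t)).frozenChain
  anchor _ := {Chain.genesis}

theorem handle_cases (t : ℕ) (C : Chain Tx) (m : Proposal Tx n Unit Unit) :
    (handle e t C m = C) ∨ (Execution.ValidProposal e t Chain.genesis m ∧ C.Pre m.chainC ∧
      handle e t C m = m.chainC) := by
  unfold handle
  split_ifs with h
  · exact Or.inr ⟨h.1, h.2, rfl⟩
  · exact Or.inl rfl

namespace Follows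

theorem votesOnce (F : Follows Δ κ e) : Execution.VotesOnce Δ e where
  vote i t h := by
    obtain ⟨D, -, heq⟩ := F.vote i t h
    exact ⟨_, rfl, rfl, heq⟩
  vote_only := F.vote_only

theorem proposesOnce (F : Follows Δ κ e) : Execution.ProposesOnce Δ e where
  propose i t h h' := by
    obtain ⟨D, -, heq⟩ := F.propose i t h h'
    exact ⟨_, rfl, rfl, heq⟩
  propose_only := F.propose_only

theorem prev_proposing_succ (F : Follows Δ κ e) (hΔ : 0 < Δ) {i : Fin n} {s : ℕ}
    (hi : e.env.Active Δ i (voting Δ (s + 1))) :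
    (prev e i (proposing Δ (s + 1))).frozenVotes = e.votes i (merging Δ s) ∧
      (prev e i (proposing Δ (s + 1))).frozenChain =
        (fastConfirmSimple (e.votes i (merging Δ s)) s).1 := by
  have key : ∀ r, merging Δ s ≤ r → r < proposing Δ (s + 1) →
      e.state i r = e.state i (merging Δ s) := by
    intro r hr
    induction r, hr using Nat.le_induction with
    | base => exact fun _ => rfl
    | succ r hr ih =>
      intro hlt
      rw [← ih (by omega)]
      have hmod : (r + 1) % (4 * Δ) = r + 1 - proposing Δ s := by
        obtain ⟨q, hq⟩ := Nat.exists_eq_add_of_le (show proposing Δ s ≤ r + 1 by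
          rw [merging_eq] at hr; omega)
        rw [proposing_succ] at hlt
        rw [hq, proposing_add_mod (by omega)]
        omega
      have hrun := hi.running_of_merging_le (r := r + 1) (by omega)
        (by rw [voting_eq]; omega)
      rw [merging_eq] at hr
      exact F.idle i (r + 1) hrun (by omega) (by omega) (by omega)
  obtain ⟨r, hr⟩ : ∃ r, proposing Δ (s + 1) = r + 1 :=
    ⟨proposing Δ (s + 1) - 1, by rw [proposing_succ]; omega⟩
  have hst : prev e i (proposing Δ (s + 1)) = e.state i (merging Δ s) := by
    rw [hr]
    exact key r (by rw [merging_eq]; rw [proposing_succ] at hr; omega) (by omega)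
  rw [hst, F.merge i s (hi.running_of_merging_le le_rfl
    ((merging_le_proposing s).trans (Nat.le_add_right _ _)))]
  exact ⟨rfl, rfl⟩

theorem frozenVotes_voting (F : Follows Δ κ e) (hΔ : 0 < Δ) {i : Fin n} {t : ℕ}
    (hi : e.env.Active Δ i (voting Δ t)) :
    (e.state i (voting Δ t)).frozenVotes = (prev e i (proposing Δ t)).frozenVotes := by
  have key : ∀ r, proposing Δ t ≤ r → r ≤ voting Δ t →
      (e.state i r).frozenVotes = (prev e i (proposing Δ t)).frozenVotes := by
    intro r hr
    induction r, hr using Nat.le_induction with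
    | base => exact fun h => (F.frozen i t _ (hi.running_of_proposing_le hΔ le_rfl h) le_rfl h).1
    | succ r hr ih =>
      intro h
      rw [← ih (by omega)]
      exact (F.frozen i t _ (hi.running_of_proposing_le hΔ (by omega) h) (by omega) h).1
  exact key _ (Nat.le_add_right _ _) le_rfl

/-- What holds of the frozen chain before some round of the handling phase and is preserved by
all received proposals still holds up to the voting round. -/
theorem frozenChain_mem (F : Follows Δ κ e) (hs : Execution.Synchronous Δ e) (hΔ : 0 < Δ)
    {i : Fin n} {t : ℕ} (hi : e.env.Active Δ i (voting Δ t)) {S : Set (Chain Tx)}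
    (hS : ∀ m ∈ e.props i (voting Δ t), ∀ C ∈ S, handle e t C m ∈ S) {r : ℕ}
    (hr : proposing Δ t ≤ r) (h₀ : (prev e i r).frozenChain ∈ S) {u : ℕ} (hu : r ≤ u)
    (hu' : u ≤ voting Δ t) : (e.state i u).frozenChain ∈ S := by
  have step : ∀ u, r ≤ u → u ≤ voting Δ t → (prev e i u).frozenChain ∈ S →
      (e.state i u).frozenChain ∈ S := fun u hu hu' hmem =>
    (F.frozen i t u (hi.running_of_proposing_le hΔ (hr.trans hu) hu') (hr.trans hu)
      hu').2.mem_of_invariant (fun m hm => hS m (hs.props_mono i hu' hm.1)) hmem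
  induction u, hu using Nat.le_induction with
  | base => exact step r le_rfl hu' h₀
  | succ u hu ih => exact step (u + 1) (by omega) hu' (ih (by omega))

/-- The proposal of an active proposer is handled, so that what it brings about, and all received
proposals preserve, holds of the frozen chain when voting. -/
theorem frozenChain_mem_of_proposal (F : Follows Δ κ e) (hs : Execution.Synchronous Δ e)
    (hΔ : 0 < Δ) {t : ℕ} (hp : e.env.Active Δ (e.env.proposer t) (proposing Δ t))
    {m : Proposal Tx n Unit Unit}
    (hm : m ∈ e.sentProps (e.env.proposer t) (proposing Δ t)) {i : Fin n}
    (hi : e.env.Active Δ i (voting Δ t)) (hview : m ∈ e.props i (voting Δ t))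
    {S S' : Set (Chain Tx)} (hS : ∀ m ∈ e.props i (voting Δ t), ∀ C ∈ S, handle e t C m ∈ S)
    (hS' : ∀ m ∈ e.props i (voting Δ t), ∀ C ∈ S', handle e t C m ∈ S')
    (hmS : ∀ C ∈ S, handle e t C m ∈ S') (h₀ : (prev e i (proposing Δ t)).frozenChain ∈ S) :
    (e.state i (voting Δ t)).frozenChain ∈ S' := by
  classical
  -- The proposal is first received in some round `u` of the handling phase.
  have hex : ∃ u, m ∈ e.props i u := ⟨_, hview⟩
  obtain ⟨u, hu, hmin⟩ : ∃ u, m ∈ e.props i u ∧ ∀ v < u, m ∉ e.props i v :=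
    ⟨Nat.find hex, Nat.find_spec hex, fun v hv => Nat.find_min hex hv⟩
  have hu' : u ≤ voting Δ t := not_lt.mp fun h => hmin _ h hview
  have hbefore := F.proposesOnce.notMem_propsBefore hs hp hm
    (hi.running_of_proposing_le hΔ le_rfl (Nat.le_add_right _ _)).1
  have hpu : proposing Δ t ≤ u := by
    by_contra hlt
    obtain ⟨r, hr⟩ : ∃ r, proposing Δ t = r + 1 := ⟨proposing Δ t - 1, by omega⟩
    rw [hr] at hbefore
    exact hbefore (hs.props_mono i (show u ≤ r by omega) hu)
  have hfirst : m ∉ e.propsBefore i u := by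
    cases u with
    | zero => exact Set.notMem_empty _
    | succ u => exact hmin u (Nat.lt_succ_self u)
  have hslot : m.slot = t := by
    obtain ⟨m', hslot, -, heq⟩ := F.proposesOnce.propose _ t hp rfl
    rw [heq] at hm
    obtain rfl : m = m' := hm
    exact hslot
  have hprev : (prev e i u).frozenChain ∈ S := by
    rcases Nat.eq_or_lt_of_le hpu with h | h
    · rw [← h]
      exact h₀
    · obtain ⟨v, rfl⟩ : ∃ v, u = v + 1 := ⟨u - 1, by omega⟩
      exact F.frozenChain_mem hs hΔ hi hS le_rfl h₀ (u := v) (by omega) (by omega)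
  have hnow : (e.state i u).frozenChain ∈ S' :=
    (F.frozen i t u (hi.running_of_proposing_le hΔ hpu hu') hpu hu').2.mem_of_mem
      (fun m hm => hS m (hs.props_mono i hu' hm.1)) (fun m hm => hS' m (hs.props_mono i hu' hm.1))
      hprev ⟨hu, hfirst, hslot⟩ hmS
  rcases Nat.eq_or_lt_of_le hu' with h | h
  · rw [← h]
    exact hnow
  · exact F.frozenChain_mem hs hΔ hi hS' (r := u + 1) (by omega) hnow h le_rfl

theorem conf_succ (F : Follows Δ κ e) (hs : Execution.Synchronous Δ e) (hn : 0 < n) (hΔ : 0 < Δ)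
    {i : Fin n} {r : ℕ} (hi : e.env.Honest i (r + 1)) :
    (e.state i (r + 1)).conf = (e.state i r).conf ∨
    (∃ s, r + 1 = voting Δ s ∧ e.env.Active Δ i (r + 1) ∧
      (e.state i (r + 1)).conf = (mfcVote Δ e i s).deepPrefix κ s) ∨
    (∃ s, r + 1 = fastConfirming Δ s ∧ e.env.Running i (r + 1) ∧
      IsQuorum (e.votes i (r + 1)) (e.state i (r + 1)).conf s) := by
  by_cases haw : e.env.awake i (r + 1)
  swap
  · exact Or.inl (congrArg TobState.conf (F.asleep i (r + 1) hi haw))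
  have hrun : e.env.Running i (r + 1) := ⟨hi, haw⟩
  obtain ⟨t, q, hq, hr, hmod⟩ := exists_round_eq hΔ (r + 1)
  rcases lt_trichotomy q Δ with hlt | rfl | hgt
  · exact Or.inl (F.conf_eq i t (r + 1) hrun (by omega) (by rw [voting_eq]; omega))
  · rw [← voting_eq] at hr
    have hv := F.conf_vote i t (hr ▸ hrun)
    rw [← hr] at hv
    by_cases hact : e.env.Active q i (r + 1)
    · have hspec := (Chain.longest_spec
        (X := {C | (C = (prev e i (r + 1)).conf ∨ C = (mfcVote q e i t).deepPrefix κ t) ∧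
          C.Pre (mfcVote q e i t)})
        ⟨_, Or.inr rfl, (Chain.deepPrefix_spec _ κ t).1⟩ (fun D hD => hD.2.p_le)).1
      rw [← hv.1 hact] at hspec
      rcases hspec.1 with h | h
      · exact Or.inl h
      · exact Or.inr (Or.inl ⟨t, hr, hact, h⟩)
    · exact Or.inl (hv.2 hact)
  · by_cases h₂ : q = 2 * Δ
    · have hr' : r + 1 = fastConfirming Δ t := by rw [fastConfirming_eq]; omega
      have hf := (F.fast_confirm i t (hr' ▸ hrun)).2.2
      rw [← hr'] at hf
      by_cases hact : e.env.Active Δ i (r + 1) ∧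
          (fastConfirmSimple (e.votes i (r + 1)) t).2 ≠ ∅
      · refine Or.inr (Or.inr ⟨t, hr', hrun, ?_⟩)
        rw [hf.1 hact]
        rcases fastConfirmSimple_cases (s := t) hn (hs.votes_finite i (r + 1)) with h | h
        · exact h.1
        · exact absurd (congrArg Prod.snd h) hact.2
      · exact Or.inl (hf.2 hact)
    · left
      by_cases h₃ : q = 3 * Δ
      · have hr' : r + 1 = merging Δ t := by rw [merging_eq]; omega
        have := F.merge i t (hr' ▸ hrun)
        rw [← hr'] at this
        rw [this]
        rfl
      · exact congrArg TobState.conf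
          (F.idle i (r + 1) hrun (by omega) (by omega) (by omega))

theorem lawful (F : Follows Δ κ e) (hc : e.env.Compliant Δ) (hs : Execution.Synchronous Δ e)
    (hΔ : 0 < Δ) : (backbone Δ e).Lawful Δ κ where
  pos := hΔ
  compliant := hc
  synchronous := hs
  frozen_zero i hi := F.frozenVotes_voting hΔ hi
  frozen_succ i s hi := (F.frozenVotes_voting hΔ hi).trans (F.prev_proposing_succ hΔ hi).1
  vote i t hi := by
    obtain ⟨D, hD, heq⟩ := F.vote i t hi
    exact ⟨D, (), hD, heq⟩
  vote_only := F.vote_only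
  propose i t hi hp := by
    obtain ⟨D, hD, heq⟩ := F.propose i t hi hp
    exact ⟨⟨D, _, _, (), t, i⟩, hD, rfl, rfl, heq⟩
  propose_only := F.propose_only
  baseP_candidate i t hi := by
    rcases fastConfirmSimple_cases (s := (t : ℤ) - 1) hc.pos (hs.votes_finite i (proposing Δ t))
      with h | h
    · exact Or.inr ⟨i, _, hi.1, Nat.le_add_right _ _, h.1⟩
    · exact Or.inl (congrArg Prod.fst h)
  baseV_candidate i t hi := by
    refine F.frozenChain_mem hs hΔ hi (S := {X | (backbone Δ e).Candidate Δ t X}) ?_ le_rfl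
      ?_ (Nat.le_add_right _ _) le_rfl
    · intro m hm C hC
      rcases handle_cases (e := e) t C m with h | ⟨hval, -, h⟩
      · rw [h]
        exact hC
      · rw [h]
        rcases hval.2.2.2 with hg | hq
        · exact Or.inl hg
        · exact Or.inr ⟨i, _, hi.1, le_rfl, hq.mono (hs.embedded i _ m hm)⟩
    · cases t with
      | zero => exact Or.inl rfl
      | succ s =>
        have hle : merging Δ s ≤ voting Δ (s + 1) :=
          (merging_le_proposing s).trans (Nat.le_add_right _ _)
        rw [(F.prev_proposing_succ hΔ hi).2]
        rcases fastConfirmSimple_cases (s := s) hc.pos (hs.votes_finite i (merging Δ s)) with h | h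
        · exact Or.inr ⟨i, merging Δ s, hi.1.of_le hle, hle, by
            rw [cast_succ_sub_one]; exact h.1⟩
        · exact Or.inl (congrArg Prod.fst h)
  lockP s _ i hi C hq j hj := by
    change C.Pre (fastConfirmSimple (e.votes j (proposing Δ (s + 1))) _).1
    rw [cast_succ_sub_one]
    exact F.votesOnce.quorum_pre_fastConfirmSimple hs hc hj.1 (hq.mono
      (hs.gossip_votes i _ j _ hi hj.running
        (by rw [fastConfirming_eq, proposing_succ]; omega)))
  lockV s _ i hi C hq j hj := by
    refine F.frozenChain_mem hs hΔ hj (S := {X | C.Pre X}) ?_ le_rfl ?_ (Nat.le_add_right _ _)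
      le_rfl
    · intro m _ X hX
      rcases handle_cases (e := e) (s + 1) X m with h | ⟨-, hpre, h⟩
      · rw [h]
        exact hX
      · rw [h]
        exact Pre.trans hX hpre
    · have hrun := hj.running_of_merging_le le_rfl
        ((merging_le_proposing s).trans (Nat.le_add_right _ _))
      rw [(F.prev_proposing_succ hΔ hj).2]
      exact F.votesOnce.quorum_pre_fastConfirmSimple hs hc hrun.1 (hq.mono
        (hs.gossip_votes i _ j _ hi hrun (by rw [fastConfirming_eq, merging_eq]; omega)))
  adopt t _ hp m hm hmp i hi hview := by
    have hm₀ := hm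
    obtain ⟨D, -, heq⟩ := F.propose _ t hp rfl
    change m ∈ e.sentProps _ _ at hm
    rw [heq] at hm
    obtain rfl : m = _ := hm
    set V := e.votes (e.env.proposer t) (proposing Δ t)
    set P := (fastConfirmSimple V ((t : ℤ) - 1)).1 with hP
    have hmem : (e.state i (voting Δ t)).frozenChain ∈ ({P} : Set (Chain Tx)) := by
      have hother : ∀ m' ∈ e.props i (voting Δ t), ∀ C, handle e t C m' = C ∨
          handle e t C m' = P := by
        intro m' hm' C
        rcases handle_cases (e := e) t C m' with h | ⟨hval, -, h⟩
        · exact Or.inl h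
        · right
          rw [h, F.proposesOnce.eq_of_sender hs hc hp hm₀ hi.1 hm' hval.1 hval.2.1]
          rfl
      refine F.frozenChain_mem_of_proposal hs hΔ hp hm₀ hi hview (S := {C | C.Pre P})
        ?_ ?_ ?_ ?_
      · intro m' hm' C hC
        rcases hother m' hm' C with h | h
        · rw [h]
          exact hC
        · rw [h]
          exact Pre.refl _
      · intro m' hm' C hC
        rcases hother m' hm' C with h | h
        · rw [h]
          exact hC
        · exact h
      · intro C hC
        unfold handle
        rw [if_pos]
        · rfl
        · exact ⟨⟨rfl, rfl, hmp, fastConfirmSimple_certified hc.pos (hs.votes_finite _ _)⟩, hC⟩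
      · cases t with
        | zero => exact Chain.genesis_pre _
        | succ s =>
          have hrun := hi.running_of_merging_le le_rfl
            ((merging_le_proposing s).trans (Nat.le_add_right _ _))
          rw [(F.prev_proposing_succ hΔ hi).2]
          rcases fastConfirmSimple_cases (s := s) hc.pos (hs.votes_finite i (merging Δ s))
            with h | h
          · rw [hP, cast_succ_sub_one]
            exact F.votesOnce.quorum_pre_fastConfirmSimple hs hc hp.1 (h.1.mono
              (hs.gossip_votes i _ _ _ hrun hp.running
                (by rw [merging_eq, proposing_succ]; omega)))
          · rw [h]
            exact Chain.genesis_pre _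
    have hbase : (backbone Δ e).baseV i t = P := hmem
    rw [hbase]
    exact ⟨Pre.refl _, Or.inl (Pre.refl _)⟩
  anchor_origin _ _ hG := Or.inl hG
  out_zero i hi := by
    change (e.state i 0).conf = _
    by_cases haw : e.env.awake i 0
    · have := F.conf_eq i 0 0 ⟨hi, haw⟩ (Nat.le_of_eq rfl) (by rw [voting_eq]; omega)
      rw [this]
      rfl
    · rw [F.asleep i 0 hi haw]
      rfl
  out_succ i r hi := by
    rcases F.conf_succ hs hc.pos hΔ hi with h | ⟨s, h₁, h₂, h⟩ | ⟨s, h₁, h₂, h⟩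
    · exact Or.inl h
    · exact Or.inr (Or.inl ⟨s, h₁, h₂, Or.inl h⟩)
    · exact Or.inr (Or.inr ⟨s, h₁, h₂, Or.inl h⟩)

end Follows

end TobExecution

/-! ### Justified checkpoints -/

section Finality

variable {Tx : Type} {n : ℕ} {V W : Set (FinVote Tx n)}

theorem Justified.mono (h : V ⊆ W) {C : Checkpoint Tx} (hC : Justified V C) : Justified W C := by
  induction hC with
  | base => exact Justified.base
  | link S T _ hL ih =>
    exact Justified.link S T ih ⟨hL.1, hL.2.1, hL.2.2.trans (Nat.mul_le_mul_left 3
      (Set.ncard_le_ncard (voters_mono fun _ hm => ⟨h hm.1, hm.2⟩) (Set.toFinite _)))⟩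

theorem greatest_spec {X : Set (Checkpoint Tx)} (hX : X.Nonempty) {N : ℕ}
    (hN : ∀ C ∈ X, C.c ≤ N) : greatest X ∈ X ∧ ∀ D ∈ X, D.c ≤ (greatest X).c := by
  have hbdd : BddAbove (Checkpoint.c '' X) := ⟨N, by rintro _ ⟨C, hC, rfl⟩; exact hN C hC⟩
  have key : ∃ C ∈ X, ∀ D ∈ X, D.c ≤ C.c := by
    obtain ⟨C, hC, h⟩ := Nat.sSup_mem (hX.image Checkpoint.c) hbdd
    exact ⟨C, hC, fun D hD => h ▸ le_csSup hbdd ⟨D, hD, rfl⟩⟩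
  unfold greatest
  rw [dif_pos key]
  exact key.choose_spec

theorem gjOf_pre_fastConfirm (V : Set (FinVote Tx n)) (s : ℤ) :
    (gjOf V).chain.Pre (fastConfirm V s).1 := by
  unfold fastConfirm
  split_ifs with h
  · exact h
  · exact Pre.refl _

theorem fastConfirm_cases (hn : 0 < n) (hV : V.Finite) (s : ℤ) :
    (IsQuorum V (fastConfirm V s).1 s ∧ fastConfirm V s = fastConfirmSimple V s) ∨
      (fastConfirm V s).1 = (gjOf V).chain := by
  unfold fastConfirm
  split_ifs with h
  · rcases fastConfirmSimple_cases (s := s) hn hV with hq | hg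
    · exact Or.inl ⟨hq.1, rfl⟩
    · right
      rw [hg] at h ⊢
      exact h.eq_genesis.symm
  · exact Or.inr rfl

end Finality

/-! ### The protocol with finality -/

namespace FfgExecution

variable {Tx : Type} {n Δ κ : ℕ} {e : FfgExecution Tx n}

/-- The anchors of slot `t` are the chains of the checkpoints that are justified in an honest view
by the voting round of slot `t`. -/
noncomputable def backbone (Δ : ℕ) (e : FfgExecution Tx n) :
    Backbone Tx n (Checkpoint Tx × Checkpoint Tx) (Checkpoint Tx) (FfgState Tx n) where
  e := e
  out i r := (e.state i r).ava
  frozenVotes i t := (e.state i (voting Δ t)).frozenVotes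
  baseP i t := (fastConfirm (e.votes i (proposing Δ t)) ((t : ℤ) - 1)).1
  baseV i t := (e.state i (voting Δ t)).frozenChain
  anchor t := {G | ∃ C : Checkpoint Tx, G = C.chain ∧
    ∃ j r, e.env.Honest j r ∧ r ≤ voting Δ t ∧ Justified (e.votes j r) C}

/-- An accepted proposal first moves the frozen chain to some `C'` that extends the justified chain
of the proposal, and then to the proposed starting chain if that extends `C'`. -/
theorem handle_of_valid {t : ℕ} {V : Set (FinVote Tx n)} {a : Chain Tx × Checkpoint Tx}
    {m : FfgProposal Tx n} (h : Execution.ValidProposal e t m.gj.chain m) (hV : Justified V m.gj)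
    (ha : m.gj = a.2 ∨ a.2.c < m.gj.c) :
    (handle e t V a m).2 = m.gj ∧
      ∃ C', (C' = a.1 ∨ (C' = m.gj.chain ∧ ¬ m.gj.chain.Pre a.1)) ∧
        ((C'.Pre m.chainC ∧ (handle e t V a m).1 = m.chainC) ∨
          (¬ C'.Pre m.chainC ∧ (handle e t V a m).1 = C')) := by
  unfold handle
  rw [if_pos ⟨h, hV, ha⟩]
  refine ⟨rfl, ?_⟩
  by_cases h₁ : m.gj.chain.Pre a.1
  · refine ⟨a.1, Or.inl rfl, ?_⟩
    by_cases h₂ : a.1.Pre m.chainC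
    · exact Or.inl ⟨h₂, by simp [h₁, h₂]⟩
    · exact Or.inr ⟨h₂, by simp [h₁, h₂]⟩
  · refine ⟨m.gj.chain, Or.inr ⟨rfl, h₁⟩, ?_⟩
    by_cases h₂ : m.gj.chain.Pre m.chainC
    · exact Or.inl ⟨h₂, by simp [h₁, h₂]⟩
    · exact Or.inr ⟨h₂, by simp [h₁, h₂]⟩

theorem handle_cases (t : ℕ) (V : Set (FinVote Tx n)) (a : Chain Tx × Checkpoint Tx)
    (m : FfgProposal Tx n) :
    handle e t V a m = a ∨
    (Execution.ValidProposal e t m.gj.chain m ∧ Justified V m.gj ∧ (handle e t V a m).2 = m.gj ∧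
      ∃ C', (C' = a.1 ∨ (C' = m.gj.chain ∧ ¬ m.gj.chain.Pre a.1)) ∧
        ((C'.Pre m.chainC ∧ (handle e t V a m).1 = m.chainC) ∨
          (¬ C'.Pre m.chainC ∧ (handle e t V a m).1 = C'))) := by
  by_cases h : Execution.ValidProposal e t m.gj.chain m ∧ Justified V m.gj ∧
      (m.gj = a.2 ∨ a.2.c < m.gj.c)
  · exact Or.inr ⟨h.1, h.2.1, handle_of_valid h.1 h.2.1 h.2.2⟩
  · exact Or.inl (if_neg h)

theorem target_c (Δ : ℕ) (e : FfgExecution Tx n) (i : Fin n) (t : ℕ) : (target Δ e i t).c = t := by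
  unfold target
  simp only
  split_ifs <;> rfl

namespace Follows

theorem votesOnce (F : Follows Δ κ e) : Execution.VotesOnce Δ e where
  vote i t h := by
    obtain ⟨D, -, heq⟩ := F.vote i t h
    exact ⟨_, rfl, rfl, heq⟩
  vote_only := F.vote_only

theorem proposesOnce (F : Follows Δ κ e) : Execution.ProposesOnce Δ e where
  propose i t h h' := by
    obtain ⟨D, -, heq⟩ := F.propose i t h h'
    exact ⟨_, rfl, rfl, heq⟩
  propose_only := F.propose_only

theorem fin_eq (F : Follows Δ κ e) (hs : Execution.Synchronous Δ e) {j : Fin n} {r : ℕ}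
    (hj : e.env.Honest j r) {m : FinVote Tx n} (hm : m ∈ e.votes j r)
    (hk : e.env.Honest m.sender r) : m.fin.2 = target Δ e m.sender m.slot := by
  obtain ⟨-, hact, hsent⟩ := F.votesOnce.origin hs hj hm hk
  obtain ⟨D, -, heq⟩ := F.vote _ _ hact
  rw [heq] at hsent
  have := Set.singleton_injective hsent
  exact congrArg (fun m : FinVote Tx n => m.fin.2) this.symm

/-- The target of a supermajority link seen by an honest validator is the target of an honest
finality vote cast earlier. -/
theorem link_origin (F : Follows Δ κ e) (hs : Execution.Synchronous Δ e)
    (hc : e.env.Compliant Δ) {j : Fin n} {r : ℕ} (hj : e.env.Honest j r) {S T : Checkpoint Tx}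
    (hL : SupermajorityLink (e.votes j r) S T) :
    voting Δ T.c < r ∧ ∃ k, e.env.Active Δ k (voting Δ T.c) ∧ T = target Δ e k T.c := by
  obtain ⟨k, ⟨m, hm, rfl⟩, -, hk⟩ := hc.exists_honest hL.2.2 hL.2.2
  have hT : T = target Δ e m.sender m.slot := by
    rw [← F.fin_eq hs hj hm.1 (hk _), hm.2]
  have hcs : T.c = m.slot := by rw [hT, target_c]
  obtain ⟨hlt, hact, -⟩ := F.votesOnce.origin hs hj hm.1 (hk _)
  rw [hcs]
  exact ⟨hlt, _, hact, hT⟩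

/-- Links with targets in the same slot share an honest voter, who votes once per slot. -/
theorem link_unique (F : Follows Δ κ e) (hs : Execution.Synchronous Δ e)
    (hc : e.env.Compliant Δ) {j j' : Fin n} {r r' : ℕ} (hj : e.env.Honest j r)
    (hj' : e.env.Honest j' r') {S T S' T' : Checkpoint Tx}
    (hL : SupermajorityLink (e.votes j r) S T) (hL' : SupermajorityLink (e.votes j' r') S' T')
    (hcc : T.c = T'.c) : T = T' := by
  obtain ⟨k, ⟨m, hm, rfl⟩, ⟨m', hm', hsend⟩, hk⟩ := hc.exists_honest hL.2.2 hL'.2.2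
  have h₁ : T = target Δ e m.sender m.slot := by
    rw [← F.fin_eq hs hj hm.1 (hk _), hm.2]
  have h₂ : T' = target Δ e m'.sender m'.slot := by
    rw [← F.fin_eq hs hj' hm'.1 (hsend ▸ hk _), hm'.2]
  have hslot : m.slot = m'.slot := by
    rw [← target_c Δ e m.sender m.slot, ← h₁, hcc, h₂, target_c]
  rw [h₁, h₂, hsend, hslot]

theorem justified_unique (F : Follows Δ κ e) (hs : Execution.Synchronous Δ e)
    (hc : e.env.Compliant Δ) {j j' : Fin n} {r r' : ℕ} (hj : e.env.Honest j r)
    (hj' : e.env.Honest j' r') {C C' : Checkpoint Tx} (hC : Justified (e.votes j r) C)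
    (hC' : Justified (e.votes j' r') C') (hcc : C.c = C'.c) : C = C' := by
  cases hC with
  | base =>
    cases hC' with
    | base => rfl
    | link S T _ hL =>
      have h₁ := hL.2.1
      have h₂ : 0 = C'.c := hcc
      omega
  | link S T _ hL =>
    cases hC' with
    | base =>
      have h₁ := hL.2.1
      have h₂ : C.c = 0 := hcc
      omega
    | link S' T' _ hL' => exact F.link_unique hs hc hj hj' hL hL' hcc

theorem gjOf_spec (F : Follows Δ κ e) (hs : Execution.Synchronous Δ e)
    (hc : e.env.Compliant Δ) (hΔ : 0 < Δ) {j : Fin n} {r : ℕ} (hj : e.env.Honest j r) :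
    Justified (e.votes j r) (gjOf (e.votes j r)) ∧
      ∀ C, Justified (e.votes j r) C → C.c ≤ (gjOf (e.votes j r)).c := by
  refine greatest_spec (X := {C | Justified (e.votes j r) C}) ⟨_, Justified.base⟩ (N := r) ?_
  intro C hC
  cases hC with
  | base => exact Nat.zero_le r
  | link S T _ hL =>
    have h₁ := (F.link_origin hs hc hj hL).1
    have h₂ : C.c ≤ proposing Δ C.c := Nat.le_mul_of_pos_left _ (by omega)
    rw [voting_eq] at h₁
    omega

theorem prev_voting_zero (F : Follows Δ κ e) (hΔ : 0 < Δ) {i : Fin n}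
    (hi : e.env.Active Δ i (voting Δ 0)) : prev e i (voting Δ 0) = start := by
  have key : ∀ r, r ≤ voting Δ 0 → prev e i r = start := by
    intro r
    induction r with
    | zero => exact fun _ => rfl
    | succ r ih =>
      intro hr
      rw [← ih (by omega)]
      have hr' : r < Δ := by
        change r + 1 ≤ 4 * Δ * 0 + Δ at hr
        omega
      have hmod : r % (4 * Δ) = r := Nat.mod_eq_of_lt (by omega)
      exact F.idle i r (hi.running_of_le hΔ (by omega)) (by omega) (by omega) (by omega)
  exact key _ le_rfl

theorem prev_voting_succ (F : Follows Δ κ e) (hΔ : 0 < Δ) {i : Fin n} {s : ℕ}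
    (hi : e.env.Active Δ i (voting Δ (s + 1))) :
    let V := e.votes i (merging Δ s)
    (prev e i (voting Δ (s + 1))).frozenVotes = V ∧
      (prev e i (voting Δ (s + 1))).frozenChain = (fastConfirm V s).1 ∧
      (prev e i (voting Δ (s + 1))).frozenGJ = gjOf V := by
  have key : ∀ r, merging Δ s ≤ r → r < voting Δ (s + 1) →
      e.state i r = e.state i (merging Δ s) := by
    intro r hr
    induction r, hr using Nat.le_induction with
    | base => exact fun _ => rfl
    | succ r hr ih =>
      intro hlt
      rw [← ih (by omega)]
      have hrun := hi.running_of_merging_le (r := r + 1) (by omega) (by omega)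
      have hne : ∀ q, Δ ≤ q → q ≤ 3 * Δ → (r + 1) % (4 * Δ) ≠ q := by
        intro q hq hq' hmod
        rw [merging_eq] at hr
        rw [voting_eq, proposing_succ] at hlt
        rcases Nat.lt_or_ge (r + 1) (proposing Δ s + 4 * Δ) with h | h
        · obtain ⟨u, hu⟩ := Nat.exists_eq_add_of_le (show proposing Δ s ≤ r + 1 by omega)
          rw [hu, proposing_add_mod (by omega)] at hmod
          omega
        · rw [← proposing_succ] at h
          obtain ⟨u, hu⟩ := Nat.exists_eq_add_of_le h
          rw [proposing_succ] at hu
          have hu' : r + 1 = proposing Δ (s + 1) + u := by rw [proposing_succ]; exact hu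
          rw [hu', proposing_add_mod (by omega)] at hmod
          omega
      exact F.idle i (r + 1) hrun (hne _ le_rfl (by omega)) (hne _ (by omega) (by omega))
        (hne _ (by omega) le_rfl)
  obtain ⟨r, hr⟩ : ∃ r, voting Δ (s + 1) = r + 1 :=
    ⟨voting Δ (s + 1) - 1, by rw [voting_eq]; omega⟩
  have hst : prev e i (voting Δ (s + 1)) = e.state i (merging Δ s) := by
    rw [hr]
    exact key r (by rw [merging_eq]; rw [voting_eq, proposing_succ] at hr; omega) (by omega)
  rw [hst, F.merge i s (hi.running_of_merging_le le_rfl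
    ((merging_le_proposing s).trans (Nat.le_add_right _ _)))]
  exact ⟨rfl, rfl, rfl⟩

theorem frozenVotes_voting (F : Follows Δ κ e) {i : Fin n} {t : ℕ}
    (hi : e.env.Active Δ i (voting Δ t)) :
    (e.state i (voting Δ t)).frozenVotes = (prev e i (voting Δ t)).frozenVotes :=
  (F.frozen i t hi.running).1

/-- What holds of the pair of frozen chain and frozen checkpoint before the voting round, and is
preserved by all received proposals, holds when voting. -/
theorem frozen_mem (F : Follows Δ κ e) {i : Fin n} {t : ℕ}
    (hi : e.env.Active Δ i (voting Δ t)) {S : Set (Chain Tx × Checkpoint Tx)}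
    (hS : ∀ m ∈ e.props i (voting Δ t), ∀ a ∈ S, handle e t (e.votes i (voting Δ t)) a m ∈ S)
    (h₀ : ((prev e i (voting Δ t)).frozenChain, (prev e i (voting Δ t)).frozenGJ) ∈ S) :
    ((e.state i (voting Δ t)).frozenChain, (e.state i (voting Δ t)).frozenGJ) ∈ S :=
  (F.frozen i t hi.running).2.mem_of_invariant (fun m hm => hS m hm.1) h₀

theorem merging_le_voting_succ (s : ℕ) : merging Δ s ≤ voting Δ (s + 1) :=
  (merging_le_proposing s).trans (Nat.le_add_right _ _)

theorem prev_frozenGJ_justified (F : Follows Δ κ e) (hs : Execution.Synchronous Δ e)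
    (hc : e.env.Compliant Δ) (hΔ : 0 < Δ) {i : Fin n} {t : ℕ}
    (hi : e.env.Active Δ i (voting Δ t)) :
    Justified (e.votes i (voting Δ t)) (prev e i (voting Δ t)).frozenGJ := by
  cases t with
  | zero =>
    rw [F.prev_voting_zero hΔ hi]
    exact Justified.base
  | succ s =>
    rw [(F.prev_voting_succ hΔ hi).2.2]
    exact (F.gjOf_spec hs hc hΔ (hi.1.of_le (merging_le_voting_succ s))).1.mono
      (hs.votes_mono i (merging_le_voting_succ s))

theorem frozenGJ_justified (F : Follows Δ κ e) (hs : Execution.Synchronous Δ e)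
    (hc : e.env.Compliant Δ) (hΔ : 0 < Δ) {i : Fin n} {t : ℕ}
    (hi : e.env.Active Δ i (voting Δ t)) :
    Justified (e.votes i (voting Δ t)) (e.state i (voting Δ t)).frozenGJ := by
  refine F.frozen_mem hi (S := {a | Justified (e.votes i (voting Δ t)) a.2}) ?_
    (F.prev_frozenGJ_justified hs hc hΔ hi)
  intro m _ a ha
  rcases handle_cases (e := e) t (e.votes i (voting Δ t)) a m with h | ⟨-, hJ, h, -⟩
  · rw [h]
    exact ha
  · change Justified _ _
    rw [h]
    exact hJ

theorem mem_anchor {j : Fin n} {r t : ℕ} (hj : e.env.Honest j r) (hr : r ≤ voting Δ t)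
    {C : Checkpoint Tx} (hC : Justified (e.votes j r) C) : C.chain ∈ (backbone Δ e).anchor t :=
  ⟨C, rfl, j, r, hj, hr, hC⟩

/-- A fast-confirmed chain has a quorum or is justified. -/
theorem fastConfirm_quorum_or_anchor (F : Follows Δ κ e) (hs : Execution.Synchronous Δ e)
    (hc : e.env.Compliant Δ) (hΔ : 0 < Δ) {j : Fin n} {r t : ℕ} (hj : e.env.Honest j r)
    (hr : r ≤ voting Δ t) (s : ℤ) :
    IsQuorum (e.votes j r) (fastConfirm (e.votes j r) s).1 s ∨
      (fastConfirm (e.votes j r) s).1 ∈ (backbone Δ e).anchor t := by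
  rcases fastConfirm_cases hc.pos (hs.votes_finite j r) s with h | h
  · exact Or.inl h.1
  · right
    rw [h]
    exact mem_anchor hj hr (F.gjOf_spec hs hc hΔ hj).1

theorem fastConfirm_candidate (F : Follows Δ κ e) (hs : Execution.Synchronous Δ e)
    (hc : e.env.Compliant Δ) (hΔ : 0 < Δ) {j : Fin n} {r t : ℕ} (hj : e.env.Honest j r)
    (hr : r ≤ voting Δ t) :
    (backbone Δ e).Candidate Δ t (fastConfirm (e.votes j r) ((t : ℤ) - 1)).1 := by
  rcases F.fastConfirm_quorum_or_anchor hs hc hΔ hj hr ((t : ℤ) - 1) with h | h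
  · exact Or.inr ⟨j, r, hj, hr, h⟩
  · exact Or.inl h

/-- As long as candidates are compatible, a justified chain that displaces a fast-confirmed one
extends it. -/
theorem quorum_pre_fastConfirm (F : Follows Δ κ e) (hs : Execution.Synchronous Δ e)
    (hc : e.env.Compliant Δ) (hΔ : 0 < Δ) {j : Fin n} {r t : ℕ}
    (hcc : (backbone Δ e).CandidatesCompatible Δ t) (hj : e.env.Honest j r)
    (hr : r ≤ voting Δ t) {C : Chain Tx} (hC : IsQuorum (e.votes j r) C ((t : ℤ) - 1)) :
    C.Pre (fastConfirm (e.votes j r) ((t : ℤ) - 1)).1 := by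
  have hpre := F.votesOnce.quorum_pre_fastConfirmSimple hs hc hj hC
  have hq := (fastConfirmSimple_of_quorum hc.pos (hs.votes_finite j r) hC).1
  unfold fastConfirm
  split_ifs with h
  · exact hpre
  · rcases hcc _ _ (Or.inr ⟨j, r, hj, hr, hq⟩)
      (Or.inl (mem_anchor hj hr (F.gjOf_spec hs hc hΔ hj).1)) with h' | h'
    · exact hpre.trans h'
    · exact absurd h' h

theorem fastConfirm_certified (hs : Execution.Synchronous Δ e) (hc : e.env.Compliant Δ)
    (j : Fin n) (r : ℕ) (s : ℤ) :
    (fastConfirm (e.votes j r) s).1 = (gjOf (e.votes j r)).chain ∨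
      IsQuorum (fastConfirm (e.votes j r) s).2 (fastConfirm (e.votes j r) s).1 s := by
  rcases fastConfirm_cases hc.pos (hs.votes_finite j r) s with ⟨hq, h⟩ | h
  · right
    rw [h] at hq ⊢
    rw [(fastConfirmSimple_of_quorum hc.pos (hs.votes_finite j r) hq).2.1]
    exact isQuorum_slotVotes hq
  · exact Or.inl h

theorem handle_candidate (hs : Execution.Synchronous Δ e) {i : Fin n} {t : ℕ}
    (hi : e.env.Active Δ i (voting Δ t)) {m : FfgProposal Tx n}
    (hm : m ∈ e.props i (voting Δ t)) {a : Chain Tx × Checkpoint Tx}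
    (ha : (backbone Δ e).Candidate Δ t a.1) :
    (backbone Δ e).Candidate Δ t (handle e t (e.votes i (voting Δ t)) a m).1 := by
  rcases handle_cases (e := e) t (e.votes i (voting Δ t)) a m with
    h | ⟨hval, hJ, -, C', hC', ⟨-, h⟩ | ⟨-, h⟩⟩
  · rw [h]
    exact ha
  · rw [h]
    rcases hval.2.2.2 with hg | hq
    · rw [hg]
      exact Or.inl (mem_anchor hi.1 le_rfl hJ)
    · exact Or.inr ⟨i, _, hi.1, le_rfl, hq.mono (hs.embedded i _ m hm)⟩
  · rw [h]
    rcases hC' with rfl | ⟨rfl, -⟩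
    · exact ha
    · exact Or.inl (mem_anchor hi.1 le_rfl hJ)

theorem pre_handle {i : Fin n} {t : ℕ} (hcc : (backbone Δ e).CandidatesCompatible Δ t)
    (hi : e.env.Active Δ i (voting Δ t)) (m : FfgProposal Tx n)
    {a : Chain Tx × Checkpoint Tx} (ha : (backbone Δ e).Candidate Δ t a.1) :
    a.1.Pre (handle e t (e.votes i (voting Δ t)) a m).1 := by
  rcases handle_cases (e := e) t (e.votes i (voting Δ t)) a m with
    h | ⟨-, hJ, -, C', hC', h⟩
  · rw [h]
    exact Pre.refl _
  · have haC : a.1.Pre C' := by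
      rcases hC' with rfl | ⟨rfl, hn⟩
      · exact Pre.refl _
      · exact (hcc _ _ ha (Or.inl (mem_anchor hi.1 le_rfl hJ))).resolve_right hn
    rcases h with ⟨hp, h⟩ | ⟨-, h⟩
    · rw [h]
      exact haC.trans hp
    · rw [h]
      exact haC

theorem prev_frozenChain (F : Follows Δ κ e) (hs : Execution.Synchronous Δ e)
    (hc : e.env.Compliant Δ) (hΔ : 0 < Δ) {i : Fin n} {t : ℕ}
    (hi : e.env.Active Δ i (voting Δ t)) :
    (prev e i (voting Δ t)).frozenChain ∈ (backbone Δ e).anchor t ∨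
      ∃ s, t = s + 1 ∧ IsQuorum (e.votes i (merging Δ s))
        (prev e i (voting Δ t)).frozenChain s := by
  cases t with
  | zero =>
    rw [F.prev_voting_zero hΔ hi]
    exact Or.inl (mem_anchor hi.1 le_rfl Justified.base)
  | succ s =>
    rw [(F.prev_voting_succ hΔ hi).2.1]
    rcases F.fastConfirm_quorum_or_anchor hs hc hΔ (hi.1.of_le (merging_le_voting_succ s))
      (merging_le_voting_succ s) (s : ℤ) with h | h
    · exact Or.inr ⟨s, rfl, h⟩
    · exact Or.inl h

theorem prev_frozenChain_candidate (F : Follows Δ κ e) (hs : Execution.Synchronous Δ e)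
    (hc : e.env.Compliant Δ) (hΔ : 0 < Δ) {i : Fin n} {t : ℕ}
    (hi : e.env.Active Δ i (voting Δ t)) :
    (backbone Δ e).Candidate Δ t (prev e i (voting Δ t)).frozenChain := by
  rcases F.prev_frozenChain hs hc hΔ hi with h | ⟨s, rfl, h⟩
  · exact Or.inl h
  · refine Or.inr ⟨i, merging Δ s, hi.1.of_le (merging_le_voting_succ s),
      merging_le_voting_succ s, ?_⟩
    rw [cast_succ_sub_one]
    exact h

theorem frozenChain_candidate (F : Follows Δ κ e) (hs : Execution.Synchronous Δ e)
    (hc : e.env.Compliant Δ) (hΔ : 0 < Δ) {i : Fin n} {t : ℕ}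
    (hi : e.env.Active Δ i (voting Δ t)) :
    (backbone Δ e).Candidate Δ t (e.state i (voting Δ t)).frozenChain :=
  F.frozen_mem hi (S := {a | (backbone Δ e).Candidate Δ t a.1})
    (fun _ hm _ ha => handle_candidate hs hi hm ha) (F.prev_frozenChain_candidate hs hc hΔ hi)

/-- The proposal of an active proposer is accepted by all voters, since the proposer has received
all votes that they had received when freezing their justified checkpoint. Justified chains need
not grow with their slots, so that a voter may keep a longer chain that was justified earlier. -/
theorem frozenChain_adopts (F : Follows Δ κ e) (hs : Execution.Synchronous Δ e)
    (hc : e.env.Compliant Δ) (hΔ : 0 < Δ) {t : ℕ}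
    (hcc : (backbone Δ e).CandidatesCompatible Δ t)
    (hp : e.env.Active Δ (e.env.proposer t) (proposing Δ t)) {m : FfgProposal Tx n}
    (hm : m ∈ e.sentProps (e.env.proposer t) (proposing Δ t)) (hmp : m.chain.p = t) {i : Fin n}
    (hi : e.env.Active Δ i (voting Δ t)) (hview : m ∈ e.props i (voting Δ t)) :
    let P := (fastConfirm (e.votes (e.env.proposer t) (proposing Δ t)) ((t : ℤ) - 1)).1
    P.Pre (e.state i (voting Δ t)).frozenChain ∧
      ((e.state i (voting Δ t)).frozenChain.Pre P ∨
        (e.state i (voting Δ t)).frozenChain ∈ (backbone Δ e).anchor t) := by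
  intro P
  set p := e.env.proposer t
  set V := e.votes p (proposing Δ t)
  set G := gjOf V
  obtain ⟨D, -, heq⟩ := F.propose p t hp rfl
  have hmeq : m = ⟨D, P, (fastConfirm V ((t : ℤ) - 1)).2, G, t, p⟩ := by
    have h := hm
    rw [heq] at h
    exact h
  have hpt : proposing Δ t ≤ voting Δ t := Nat.le_add_right _ _
  have hVi : V ⊆ e.votes i (voting Δ t) :=
    hs.gossip_votes p _ i _ hp.running hi.running (by rw [voting_eq])
  have hGspec := F.gjOf_spec hs hc hΔ hp.1
  have hGanchor : G.chain ∈ (backbone Δ e).anchor t := mem_anchor hp.1 hpt hGspec.1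
  have hPcand : (backbone Δ e).Candidate Δ t P := F.fastConfirm_candidate hs hc hΔ hp.1 hpt
  have hGP : G.chain.Pre P := gjOf_pre_fastConfirm _ _
  have hval : Execution.ValidProposal e t m.gj.chain m := by
    subst hmeq
    exact ⟨rfl, rfl, hmp, fastConfirm_certified hs hc p _ _⟩
  have hmgj : m.gj = G := by rw [hmeq]
  have hmC : m.chainC = P := by rw [hmeq]
  have hJ : Justified (e.votes i (voting Δ t)) m.gj := hmgj ▸ hGspec.1.mono hVi
  have hother : ∀ m' ∈ e.props i (voting Δ t), ∀ a,
      handle e t (e.votes i (voting Δ t)) a m' = a ∨ m' = m := by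
    intro m' hm' a
    rcases handle_cases (e := e) t (e.votes i (voting Δ t)) a m' with h | ⟨hv, -⟩
    · exact Or.inl h
    · exact Or.inr (F.proposesOnce.eq_of_sender hs hc hp hm hi.1 hm' hv.1 hv.2.1)
  -- The effect of the proposal on a state that has not yet overtaken the proposer.
  have hmain : ∀ a : Chain Tx × Checkpoint Tx, (backbone Δ e).Candidate Δ t a.1 →
      (a.1.Pre P ∨ a.1 ∈ (backbone Δ e).anchor t) → (G = a.2 ∨ a.2.c < G.c) →
      let b := handle e t (e.votes i (voting Δ t)) a m
      P.Pre b.1 ∧ (b.1.Pre P ∨ b.1 ∈ (backbone Δ e).anchor t) ∧ b.2 = G := by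
    intro a ha₁ ha₂ ha₃ b
    obtain ⟨h₂, C', hC', h⟩ := handle_of_valid hval hJ (hmgj.symm ▸ ha₃)
    rw [hmgj] at h₂ hC'
    rw [hmC] at h
    rcases h with ⟨-, h⟩ | ⟨hn, h⟩
    · change b.1 = P at h
      rw [h]
      exact ⟨Pre.refl _, Or.inl (Pre.refl _), h₂⟩
    · change b.1 = C' at h
      rw [h]
      have hC'cand : (backbone Δ e).Candidate Δ t C' := by
        rcases hC' with rfl | ⟨rfl, -⟩
        · exact ha₁
        · exact Or.inl hGanchor
      refine ⟨(hcc _ _ hPcand hC'cand).resolve_right hn, ?_, h₂⟩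
      rcases hC' with rfl | ⟨rfl, -⟩
      · exact ha₂
      · exact Or.inl hGP
  have hres : ((e.state i (voting Δ t)).frozenChain, (e.state i (voting Δ t)).frozenGJ) ∈
      {a : Chain Tx × Checkpoint Tx | (backbone Δ e).Candidate Δ t a.1 ∧
        (a.1.Pre P ∨ a.1 ∈ (backbone Δ e).anchor t) ∧ (G = a.2 ∨ a.2.c < G.c) ∧ P.Pre a.1} := by
    refine (F.frozen i t hi.running).2.mem_of_mem
      (S := {a : Chain Tx × Checkpoint Tx | (backbone Δ e).Candidate Δ t a.1 ∧
        (a.1.Pre P ∨ a.1 ∈ (backbone Δ e).anchor t) ∧ (G = a.2 ∨ a.2.c < G.c)})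
      ?_ ?_ ?_ (m := m) ?_ ?_
    · rintro m' hm' a ⟨ha₁, ha₂, ha₃⟩
      rcases hother m' hm'.1 a with h | rfl
      · rw [h]
        exact ⟨ha₁, ha₂, ha₃⟩
      · have := hmain a ha₁ ha₂ ha₃
        exact ⟨handle_candidate hs hi hm'.1 ha₁, this.2.1, Or.inl this.2.2.symm⟩
    · rintro m' hm' a ⟨ha₁, ha₂, ha₃, ha₄⟩
      rcases hother m' hm'.1 a with h | rfl
      · rw [h]
        exact ⟨ha₁, ha₂, ha₃, ha₄⟩
      · have := hmain a ha₁ ha₂ ha₃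
        exact ⟨handle_candidate hs hi hm'.1 ha₁, this.2.1, Or.inl this.2.2.symm, this.1⟩
    · refine ⟨F.prev_frozenChain_candidate hs hc hΔ hi, ?_, ?_⟩
      · rcases F.prev_frozenChain hs hc hΔ hi with h | ⟨s, rfl, h⟩
        · exact Or.inr h
        · left
          have hrun := hi.running_of_merging_le le_rfl (merging_le_voting_succ s)
          refine F.quorum_pre_fastConfirm hs hc hΔ hcc hp.1 hpt ?_
          rw [cast_succ_sub_one]
          exact h.mono (hs.gossip_votes i _ _ _ hrun hp.running
            (by rw [merging_eq, proposing_succ]; omega))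
      · have hJV : Justified V (prev e i (voting Δ t)).frozenGJ := by
          cases t with
          | zero =>
            rw [F.prev_voting_zero hΔ hi]
            exact Justified.base
          | succ s =>
            have hrun := hi.running_of_merging_le le_rfl (merging_le_voting_succ s)
            rw [(F.prev_voting_succ hΔ hi).2.2]
            exact (F.gjOf_spec hs hc hΔ hrun.1).1.mono (hs.gossip_votes i _ _ _ hrun hp.running
              (by rw [merging_eq, proposing_succ]; omega))
        rcases Nat.eq_or_lt_of_le (hGspec.2 _ hJV) with h | h
        · exact Or.inl (F.justified_unique hs hc hp.1 hp.1 hGspec.1 hJV h.symm)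
        · exact Or.inr h
    · exact ⟨hview, F.proposesOnce.notMem_propsBefore hs hp hm (hi.1.of_le hpt), hval.1⟩
    · rintro a ⟨ha₁, ha₂, ha₃⟩
      have := hmain a ha₁ ha₂ ha₃
      exact ⟨handle_candidate hs hi hview ha₁, this.2.1, Or.inl this.2.2.symm, this.1⟩
  exact ⟨hres.2.2.2, hres.2.1⟩

theorem ava_succ (F : Follows Δ κ e) (hs : Execution.Synchronous Δ e) (hc : e.env.Compliant Δ)
    (hΔ : 0 < Δ) {i : Fin n} {r : ℕ} (hi : e.env.Honest i (r + 1)) :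
    (e.state i (r + 1)).ava = (e.state i r).ava ∨
    (∃ s, r + 1 = voting Δ s ∧ e.env.Active Δ i (r + 1) ∧
      ((e.state i (r + 1)).ava = (mfcVote Δ e i s).deepPrefix κ s ∨
        (e.state i (r + 1)).ava ∈ (backbone Δ e).anchor s)) ∨
    (∃ s, r + 1 = fastConfirming Δ s ∧ e.env.Running i (r + 1) ∧
      (IsQuorum (e.votes i (r + 1)) (e.state i (r + 1)).ava s ∨
        (e.state i (r + 1)).ava ∈ (backbone Δ e).anchor (s + 1))) := by
  by_cases haw : e.env.awake i (r + 1)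
  swap
  · exact Or.inl (congrArg FfgState.ava (F.asleep i (r + 1) hi haw))
  have hrun : e.env.Running i (r + 1) := ⟨hi, haw⟩
  obtain ⟨t, q, hq, hr, hmod⟩ := exists_round_eq hΔ (r + 1)
  by_cases h₁ : q = Δ
  · subst h₁
    rw [← voting_eq] at hr
    have hv := F.out_vote i t (hr ▸ hrun)
    by_cases hact : e.env.Active q i (r + 1)
    · have hact' := hact
      rw [hr] at hact'
      have hspec := (Chain.longest_spec
        (X := {C | (C = (prev e i (voting q t)).ava ∨ C = (mfcVote q e i t).deepPrefix κ t ∨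
          C = (e.state i (voting q t)).frozenGJ.chain) ∧ C.Pre (mfcVote q e i t)})
        ⟨_, Or.inr (Or.inl rfl), (Chain.deepPrefix_spec _ κ t).1⟩ (fun D hD => hD.2.p_le)).1
      rw [← (hv.1 hact').1] at hspec
      rcases hspec.1 with h | h | h
      · rw [← hr] at h
        exact Or.inl h
      · rw [← hr] at h
        exact Or.inr (Or.inl ⟨t, hr, hact, Or.inl h⟩)
      · refine Or.inr (Or.inl ⟨t, hr, hact, Or.inr ?_⟩)
        rw [hr, h]
        exact mem_anchor hact'.1 le_rfl (F.frozenGJ_justified hs hc hΔ hact')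
    · have h := (hv.2 (hr ▸ hact)).1
      rw [← hr] at h
      exact Or.inl h
  · by_cases h₂ : q = 2 * Δ
    · have hr' : r + 1 = fastConfirming Δ t := by rw [fastConfirming_eq]; omega
      have hf := (F.fast_confirm i t (hr' ▸ hrun)).2.2.2
      rw [← hr'] at hf
      by_cases hact : e.env.Active Δ i (r + 1)
      · by_cases hpre : (fastConfirm (e.votes i (r + 1)) t).1.Pre (prev e i (r + 1)).ava
        · exact Or.inl ((hf.1 hact).2.1 hpre)
        · refine Or.inr (Or.inr ⟨t, hr', hrun, ?_⟩)
          rw [(hf.1 hact).1 hpre]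
          exact F.fastConfirm_quorum_or_anchor hs hc hΔ hi
            (by rw [hr', fastConfirming_eq, voting_eq, proposing_succ]; omega) (t : ℤ)
      · exact Or.inl (hf.2 hact).1
    · left
      by_cases h₃ : q = 3 * Δ
      · have hr' : r + 1 = merging Δ t := by rw [merging_eq]; omega
        have := F.merge i t (hr' ▸ hrun)
        rw [← hr'] at this
        rw [this]
        rfl
      · exact congrArg FfgState.ava
          (F.idle i (r + 1) hrun (by omega) (by omega) (by omega))

theorem anchor_origin (F : Follows Δ κ e) (hs : Execution.Synchronous Δ e)
    (hc : e.env.Compliant Δ) (hΔ : 0 < Δ) (t : ℕ) (G : Chain Tx)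
    (hG : G ∈ (backbone Δ e).anchor t) : G = Chain.genesis ∨
    ∃ s < t, ∃ k, e.env.Active Δ k (voting Δ s) ∧
      (G = (e.state k (voting Δ s)).ava ∨ G ∈ (backbone Δ e).anchor s) := by
  obtain ⟨C, rfl, j, r, hj, hr, hC⟩ := hG
  cases hC with
  | base => exact Or.inl rfl
  | link S T _ hL =>
    obtain ⟨hlt, k, hk, hT⟩ := F.link_origin hs hc hj hL
    refine Or.inr ⟨C.c, lt_of_voting_lt_voting (lt_of_lt_of_le hlt hr), k, hk, ?_⟩
    have hchain : C.chain = (target Δ e k C.c).chain := congrArg Checkpoint.chain hT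
    rw [hchain]
    unfold target
    simp only
    split_ifs
    · exact Or.inl rfl
    · exact Or.inr (mem_anchor (C := (e.state k (voting Δ C.c)).frozenGJ) hk.1 le_rfl
        (F.frozenGJ_justified hs hc hΔ hk))

theorem lawful (F : Follows Δ κ e) (hc : e.env.Compliant Δ) (hs : Execution.Synchronous Δ e)
    (hΔ : 0 < Δ) : (backbone Δ e).Lawful Δ κ where
  pos := hΔ
  compliant := hc
  synchronous := hs
  frozen_zero i hi := (F.frozenVotes_voting hi).trans (by rw [F.prev_voting_zero hΔ hi]; rfl)
  frozen_succ i s hi := (F.frozenVotes_voting hi).trans (F.prev_voting_succ hΔ hi).1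
  vote i t hi := by
    obtain ⟨D, hD, heq⟩ := F.vote i t hi
    exact ⟨D, _, hD, heq⟩
  vote_only := F.vote_only
  propose i t hi hp := by
    obtain ⟨D, hD, heq⟩ := F.propose i t hi hp
    exact ⟨⟨D, _, _, _, t, i⟩, hD, rfl, rfl, heq⟩
  propose_only := F.propose_only
  baseP_candidate i t hi := F.fastConfirm_candidate hs hc hΔ hi.1 (Nat.le_add_right _ _)
  baseV_candidate i t hi := F.frozenChain_candidate hs hc hΔ hi
  lockP s hcc i hi C hq j hj := by
    refine F.quorum_pre_fastConfirm hs hc hΔ hcc hj.1 (Nat.le_add_right _ _) ?_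
    rw [cast_succ_sub_one]
    exact hq.mono (hs.gossip_votes i _ j _ hi hj.running
      (by rw [fastConfirming_eq, proposing_succ]; omega))
  lockV s hcc i hi C hq j hj := by
    have hrun := hj.running_of_merging_le le_rfl (merging_le_voting_succ s)
    have hstart : C.Pre (prev e j (voting Δ (s + 1))).frozenChain := by
      rw [(F.prev_voting_succ hΔ hj).2.1, ← cast_succ_sub_one]
      refine F.quorum_pre_fastConfirm hs hc hΔ hcc hrun.1 (merging_le_voting_succ s) ?_
      rw [cast_succ_sub_one]
      exact hq.mono (hs.gossip_votes i _ j _ hi hrun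
        (by rw [fastConfirming_eq, merging_eq]; omega))
    have := F.frozen_mem hj
      (S := {a | (backbone Δ e).Candidate Δ (s + 1) a.1 ∧ C.Pre a.1})
      (fun m hm a ha => ⟨handle_candidate hs hj hm ha.1, ha.2.trans (pre_handle hcc hj m ha.1)⟩)
      ⟨F.prev_frozenChain_candidate hs hc hΔ hj, hstart⟩
    exact this.2
  adopt t hcc hp m hm hmp i hi hview := F.frozenChain_adopts hs hc hΔ hcc hp hm hmp hi hview
  anchor_origin := F.anchor_origin hs hc hΔ
  out_zero i hi := by
    change (e.state i 0).ava = _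
    have : e.state i 0 = prev e i 0 := by
      by_cases haw : e.env.awake i 0
      · exact F.idle i 0 ⟨hi, haw⟩ (by rw [Nat.zero_mod]; omega) (by rw [Nat.zero_mod]; omega)
          (by rw [Nat.zero_mod]; omega)
      · exact F.asleep i 0 hi haw
    rw [this]
    rfl
  out_succ _ _ hi := F.ava_succ hs hc hΔ hi

end Follows

end FfgExecution

/-! ### The probability of a window without an active proposer -/

section Probability

variable {Ω : Type} {n Δ κ T h : ℕ} {env : Ω → Env n}

/-- The event that the proposer of slot `t` is not active when it should propose. -/
def inactiveProposer (Δ : ℕ) (env : Ω → Env n) (t : ℕ) : Set Ω :=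
  {ω | ¬ (env ω).Active Δ ((env ω).proposer t) (proposing Δ t)}

theorem inactiveProposer_eq (Δ : ℕ) (env : Ω → Env n) (t : ℕ) :
    inactiveProposer Δ env t =
      ⋃ k, {ω | ¬ (env ω).Active Δ k (proposing Δ t)} ∩ {ω | (env ω).proposer t = k} := by
  ext ω
  simp [inactiveProposer]

/-- The event that none of the `κ` slots from `s` on has an active proposer. -/
def inactiveWindow (Δ : ℕ) (env : Ω → Env n) (s κ : ℕ) : Set Ω :=
  {ω | ∀ t, s ≤ t → t < s + κ → ω ∈ inactiveProposer Δ env t}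

theorem inactiveWindow_succ (s κ : ℕ) : inactiveWindow Δ env s (κ + 1) =
    inactiveWindow Δ env s κ ∩ inactiveProposer Δ env (s + κ) := by
  ext ω
  constructor
  · exact fun hω => ⟨fun t h₁ h₂ => hω t h₁ (by omega), hω _ (by omega) (by omega)⟩
  · intro hω t h₁ h₂
    rcases Nat.lt_or_ge t (s + κ) with h₃ | h₃
    · exact hω.1 t h₁ h₃
    · obtain rfl : t = s + κ := by omega
      exact hω.2

theorem inactiveWindow_zero (s : ℕ) : inactiveWindow Δ env s 0 = Set.univ :=
  Set.eq_univ_of_forall fun _ _ h₁ h₂ => absurd h₂ (by omega)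

variable [mΩ : MeasurableSpace Ω] {μ : Measure Ω} {ℱ : Filtration ℕ mΩ}

theorem FairElection.measurableSet_inactive (F : FairElection Δ μ ℱ env) (t : ℕ) (k : Fin n) :
    MeasurableSet[ℱ t] {ω | ¬ (env ω).Active Δ k (proposing Δ t)} :=
  (F.activity t k).compl

theorem FairElection.measurableSet_inactiveProposer (F : FairElection Δ μ ℱ env) (t : ℕ) :
    MeasurableSet[ℱ (t + 1)] (inactiveProposer Δ env t) := by
  rw [inactiveProposer_eq]
  exact MeasurableSet.iUnion fun k =>
    (ℱ.mono (Nat.le_succ t) _ (F.measurableSet_inactive t k)).inter (F.revealed t k)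

/-- Given the past, the proposer of a slot with at least `h` active validators is inactive with
probability at most `(n - h) / n`. -/
theorem FairElection.measure_inter_inactiveProposer_le (F : FairElection Δ μ ℱ env) {t : ℕ}
    (hh : ∀ ω, h ≤ ((env ω).active Δ (proposing Δ t)).ncard) {B : Set Ω}
    (hB : MeasurableSet[ℱ t] B) :
    μ (B ∩ inactiveProposer Δ env t) ≤ ((n - h : ℕ) : ℝ≥0∞) * (n : ℝ≥0∞)⁻¹ * μ B := by
  classical
  set N : Fin n → Set Ω := fun k => {ω | ¬ (env ω).Active Δ k (proposing Δ t)} with hN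
  have hNm : ∀ k, MeasurableSet[ℱ t] (N k) := F.measurableSet_inactive t
  have hsum : ∑ k, μ (B ∩ N k) ≤ ((n - h : ℕ) : ℝ≥0∞) * μ B := by
    have hBm : MeasurableSet B := ℱ.le t _ hB
    have hBN : ∀ k, MeasurableSet (B ∩ N k) := fun k => hBm.inter (ℱ.le t _ (hNm k))
    calc ∑ k, μ (B ∩ N k) = ∑ k, ∫⁻ ω, (B ∩ N k).indicator 1 ω ∂μ :=
          Finset.sum_congr rfl fun k _ => (lintegral_indicator_one (hBN k)).symm
      _ = ∫⁻ ω, ∑ k, (B ∩ N k).indicator 1 ω ∂μ :=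
          (lintegral_finsetSum _ fun k _ => measurable_one.indicator (hBN k)).symm
      _ ≤ ∫⁻ ω, B.indicator (fun _ => ((n - h : ℕ) : ℝ≥0∞)) ω ∂μ := by
          refine lintegral_mono fun ω => ?_
          by_cases hω : ω ∈ B
          · rw [Set.indicator_of_mem hω]
            have hterm : ∀ k, (B ∩ N k).indicator (1 : Ω → ℝ≥0∞) ω =
                if k ∈ ((env ω).active Δ (proposing Δ t))ᶜ then 1 else 0 := by
              intro k
              by_cases hk : (env ω).Active Δ k (proposing Δ t)
              · rw [Set.indicator_of_notMem fun hm => hm.2 hk, if_neg fun hm => hm hk]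
              · rw [Set.indicator_of_mem (show ω ∈ B ∩ N k from ⟨hω, hk⟩),
                  if_pos (show k ∈ ((env ω).active Δ (proposing Δ t))ᶜ from hk)]
                rfl
            simp only [hterm, Finset.sum_boole]
            refine Nat.cast_le.mpr ?_
            have h₁ := Set.ncard_add_ncard_compl ((env ω).active Δ (proposing Δ t))
            rw [Nat.card_eq_fintype_card, Fintype.card_fin] at h₁
            have h₂ : (Finset.univ.filter fun k =>
                k ∈ ((env ω).active Δ (proposing Δ t))ᶜ).card =
                (((env ω).active Δ (proposing Δ t))ᶜ).ncard := by
              rw [← Set.ncard_coe_finset]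
              congr 1
              ext k
              simp
            have h₃ := hh ω
            omega
          · rw [Set.indicator_of_notMem hω]
            exact le_of_eq (Finset.sum_eq_zero fun k _ =>
              Set.indicator_of_notMem (fun hm => hω hm.1) _)
      _ = ((n - h : ℕ) : ℝ≥0∞) * μ B := lintegral_indicator_const hBm _
  have hpart : ∀ k, μ (B ∩ N k ∩ {ω | (env ω).proposer t = k}) = μ (B ∩ N k) * (n : ℝ≥0∞)⁻¹ :=
    fun k => by rw [F.unpredictable t k _ (hB.inter (hNm k)), F.uniform]
  calc μ (B ∩ inactiveProposer Δ env t)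
      = μ (⋃ k, B ∩ N k ∩ {ω | (env ω).proposer t = k}) := by
        rw [inactiveProposer_eq, Set.inter_iUnion]
        simp only [Set.inter_assoc, hN]
    _ ≤ ∑ k, μ (B ∩ N k ∩ {ω | (env ω).proposer t = k}) := measure_iUnion_fintype_le _ _
    _ = (∑ k, μ (B ∩ N k)) * (n : ℝ≥0∞)⁻¹ := by
        rw [Finset.sum_mul]
        exact Finset.sum_congr rfl fun k _ => hpart k
    _ ≤ ((n - h : ℕ) : ℝ≥0∞) * μ B * (n : ℝ≥0∞)⁻¹ := mul_le_mul_left hsum _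
    _ = ((n - h : ℕ) : ℝ≥0∞) * (n : ℝ≥0∞)⁻¹ * μ B := mul_right_comm _ _ _

theorem FairElection.measurableSet_inactiveWindow (F : FairElection Δ μ ℱ env) (s κ : ℕ) :
    MeasurableSet[ℱ (s + κ)] (inactiveWindow Δ env s κ) := by
  induction κ with
  | zero =>
    rw [inactiveWindow_zero]
    exact MeasurableSet.univ
  | succ κ ih =>
    rw [inactiveWindow_succ]
    exact (ℱ.mono (Nat.le_succ _) _ ih).inter (F.measurableSet_inactiveProposer (s + κ))

theorem FairElection.measure_inactiveWindow_le [IsProbabilityMeasure μ]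
    (F : FairElection Δ μ ℱ env) {s κ : ℕ}
    (hh : ∀ ω, ∀ t < T, h ≤ ((env ω).active Δ (proposing Δ t)).ncard) (hs : s + κ ≤ T) :
    μ (inactiveWindow Δ env s κ) ≤ (((n - h : ℕ) : ℝ≥0∞) * (n : ℝ≥0∞)⁻¹) ^ κ := by
  induction κ with
  | zero =>
    rw [pow_zero]
    exact prob_le_one
  | succ κ ih =>
    rw [inactiveWindow_succ, pow_succ']
    exact (F.measure_inter_inactiveProposer_le (fun ω => hh ω _ (by omega))
      (F.measurableSet_inactiveWindow s κ)).trans (mul_le_mul_right (ih (by omega)) _)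

/-- Union bound over the windows that end within the first `T` slots. -/
theorem FairElection.measure_not_pivotal_le [IsProbabilityMeasure μ]
    (F : FairElection Δ μ ℱ env) (hn : 0 < n) (hh : ∀ ω, ∀ t < T, h ≤ ((env ω).active Δ (proposing Δ t)).ncard) :
    μ {ω | ¬ (env ω).Pivotal Δ κ T} ≤ ENNReal.ofReal (T * (1 - (h : ℝ) / n) ^ κ) := by
  rcases Nat.eq_zero_or_pos T with rfl | hT
  · have : {ω | ¬ (env ω).Pivotal Δ κ 0} = ∅ :=
      Set.eq_empty_of_forall_notMem fun ω hω => hω fun s hs => absurd hs (by omega)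
    rw [this, measure_empty]
    exact zero_le
  have hhn : h ≤ n := by
    obtain ⟨ω⟩ := nonempty_of_isProbabilityMeasure μ
    refine (hh ω 0 hT).trans ?_
    simpa using Set.ncard_le_card ((env ω).active Δ (proposing Δ 0))
  have hsub : {ω | ¬ (env ω).Pivotal Δ κ T} ⊆
      ⋃ s ∈ (Finset.range T).filter (fun s => s + κ ≤ T), inactiveWindow Δ env s κ := by
    intro ω hω
    have hω' : ¬ (env ω).Pivotal Δ κ T := hω
    unfold Env.Pivotal at hω'
    push Not at hω'
    obtain ⟨s, hs, hall⟩ := hω'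
    refine Set.mem_iUnion₂.mpr ⟨s, Finset.mem_filter.mpr ⟨Finset.mem_range.mpr (by omega),
      by omega⟩, fun t h₁ h₂ => hall t h₁ h₂⟩
  have hn' : (0 : ℝ) < n := Nat.cast_pos.mpr hn
  have hratio : ((n - h : ℕ) : ℝ≥0∞) * (n : ℝ≥0∞)⁻¹ = ENNReal.ofReal (1 - (h : ℝ) / n) := by
    rw [← div_eq_mul_inv, one_sub_div hn'.ne', ENNReal.ofReal_div_of_pos hn', ← Nat.cast_sub hhn,
      ENNReal.ofReal_natCast, ENNReal.ofReal_natCast]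
  have hnonneg : (0 : ℝ) ≤ 1 - (h : ℝ) / n :=
    sub_nonneg.mpr (div_le_one_of_le₀ (Nat.cast_le.mpr hhn) hn'.le)
  calc μ {ω | ¬ (env ω).Pivotal Δ κ T}
      ≤ ∑ s ∈ (Finset.range T).filter (fun s => s + κ ≤ T), μ (inactiveWindow Δ env s κ) :=
        (measure_mono hsub).trans (measure_biUnion_finset_le _ _)
    _ ≤ ∑ _s ∈ (Finset.range T).filter (fun s => s + κ ≤ T),
          ENNReal.ofReal (1 - (h : ℝ) / n) ^ κ := by
        refine Finset.sum_le_sum fun s hs => ?_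
        rw [← hratio]
        exact F.measure_inactiveWindow_le hh (Finset.mem_filter.mp hs).2
    _ ≤ T * ENNReal.ofReal (1 - (h : ℝ) / n) ^ κ := by
        rw [Finset.sum_const, nsmul_eq_mul]
        refine mul_le_mul_left (Nat.cast_le.mpr ?_) _
        simpa using Finset.card_filter_le (Finset.range T) (fun s => s + κ ≤ T)
    _ = ENNReal.ofReal (T * (1 - (h : ℝ) / n) ^ κ) := by
        rw [ENNReal.ofReal_mul (Nat.cast_nonneg T), ENNReal.ofReal_natCast,
          ENNReal.ofReal_pow hnonneg]

end Probability

end Sleepy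

open Sleepy in
theorem mainTheorem3 {Tx Ω : Type} [mΩ : MeasurableSpace Ω] (μ : Measure Ω)
    [IsProbabilityMeasure μ] (ℱ : Filtration ℕ mΩ) (n Δ κ T h : ℕ) (hΔ : 0 < Δ) :
    (∀ e : Ω → TobExecution Tx n,
      (∀ ω, (e ω).env.Compliant Δ ∧ Execution.Synchronous Δ (e ω) ∧
        TobExecution.Follows Δ κ (e ω)) →
      FairElection Δ μ ℱ (fun ω => (e ω).env) →
      (∀ ω, ∀ t < T, h ≤ ((e ω).env.active Δ (proposing Δ t)).ncard) →
      μ {ω | ¬ (ReorgResilient Δ T (e ω) (fun i r => ((e ω).state i r).conf) ∧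
          OutputsCanonical Δ T (e ω) (fun i r => ((e ω).state i r).conf)
            (TobExecution.mfcPropose Δ (e ω)) (TobExecution.mfcVote Δ (e ω)))} ≤
        ENNReal.ofReal (T * (1 - (h : ℝ) / n) ^ κ)) ∧
    (∀ e : Ω → FfgExecution Tx n,
      (∀ ω, (e ω).env.Compliant Δ ∧ Execution.Synchronous Δ (e ω) ∧
        FfgExecution.Follows Δ κ (e ω)) →
      FairElection Δ μ ℱ (fun ω => (e ω).env) →
      (∀ ω, ∀ t < T, h ≤ ((e ω).env.active Δ (proposing Δ t)).ncard) →
      μ {ω | ¬ (ReorgResilient Δ T (e ω) (fun i r => ((e ω).state i r).ava) ∧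
          OutputsCanonical Δ T (e ω) (fun i r => ((e ω).state i r).ava)
            (FfgExecution.mfcPropose Δ (e ω)) (FfgExecution.mfcVote Δ (e ω)))} ≤
        ENNReal.ofReal (T * (1 - (h : ℝ) / n) ^ κ)) := by
  obtain ⟨ω₀⟩ := nonempty_of_isProbabilityMeasure μ
  constructor
  · intro e he F hh
    refine le_trans (measure_mono ?_) (F.measure_not_pivotal_le (κ := κ) (he ω₀).1.pos hh)
    intro ω hω hpiv
    have L := (he ω).2.2.lawful (he ω).1 (he ω).2.1 hΔ
    exact hω ⟨L.reorgResilient hpiv, L.outputsCanonical hpiv⟩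
  · intro e he F hh
    refine le_trans (measure_mono ?_) (F.measure_not_pivotal_le (κ := κ) (he ω₀).1.pos hh)
    intro ω hω hpiv
    have L := (he ω).2.2.lawful (he ω).1 (he ω).2.1 hΔ
    exact hω ⟨L.reorgResilient hpiv, L.outputsCanonical hpiv⟩
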